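/- For a finite group $G$, let $R(G)=R_{\mathbb C}(G)$ be the ring of virtual complex characters of $G$, with augmentation $\epsilon:R(G)\to\mathbb Z$ (the degree), augmentation ideal $I=\ker\epsilon$, and the $\lambda$-operations extending $\lambda^n(\chi_V)=\chi_{\Lambda^nV}$. Put $\gamma^n(x)=\lambda^n(x+n-1)$, let $\Gamma^n\subseteq R(G)$ be the additive subgroup generated by the products $\gamma^{n_1}(x_1)\cdots\gamma^{n_k}(x_k)$ with $x_i\in I$ and $\sum_i n_i\ge n$, and let $R^*_{\mathbb C}(G)=\bigoplus_{n\ge0}\Gamma^n/\Gamma^{n+1}$ be the graded character ring. For a virtual character $\chi$, let $c_n(\chi)\in R^*_{\mathbb C}(G)$ be the class in degree $n$ of $\gamma^n(\chi-\epsilon(\chi))$. A homomorphism $H\to G$ induces a homomorphism $R^*_{\mathbb C}(G)\to R^*_{\mathbb C}(H)$; this gives restriction maps $\mathrm{res}^H_K:R^*_{\mathbb C}(H)\to R^*_{\mathbb C}(K)$ for $K\le H$ and conjugation maps $c_g:R^*_{\mathbb C}(H)\to R^*_{\mathbb C}({}^gH)$, where ${}^gH=gHg^{-1}$. **Theorem.**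 The functor $R^*_{\mathbb C}(-)$ is not a Mackey functor. More precisely, let $G=A_4$. 1. There are no additive maps $\mathrm{ind}^H_K:R^*_{\mathbb C}(K)\to R^*_{\mathbb C}(H)$, for $K\le H\le G$, which together with the maps $\mathrm{res}^H_K$ and $c_g$ satisfy the axioms of a Mackey functor on the subgroups of $G$ (identities, transitivity of restriction and of induction, $c_gc_h=c_{gh}$, compatibility of restriction and induction with conjugation, and the Mackey formula $\mathrm{res}^H_J\,\mathrm{ind}^H_K=\sum_{x\in[J\backslash H/K]}\mathrm{ind}^J_{J\cap{}^xK}\,c_x\,\mathrm{res}^K_{J^x\cap K}$ for $J,K\le H$, where $J^x=x^{-1}Jx$). 2. Let $P$ be the $2$-Sylow subgroup of $A_4$, so $P\cong C_2\times C_2$. The image of the restriction map $R^*_{\mathbb C}(A_4)\to R^*_{\mathbb C}(P)$ is strictly contained in the set $R^*_{\mathbb C}(P)^{N_G(P)}$ of elements fixed by $c_g$ for all $g$ in the normalizer $N_G(P)$. 3. Let $\rho$ be the one-dimensional representation of $A_4$ with $\rho((1\,2\,3))=e^{2\pi i/3}$ and $\rho((1\,2)(3\,4))=1$, and let $\theta$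 be the standard three-dimensional representation (the quotient of the permutation representation on $\mathbb C^4$ by the trivial one). There is a ring isomorphism $$\mathbb Z[x,y]/(3x,\,12y,\,4y+x^2)\;\cong\;R^*_{\mathbb C}(A_4),\qquad x\mapsto c_1(\rho),\quad y\mapsto c_2(\theta).$$ -/

import Mathlib

namespace GradedCharacterRing

noncomputable section

open Polynomial in
/-- The polynomial `det (1 + t A)`, seen as a power series. -/
def detSeries {K : Type*} [Field K] {n : ℕ} (A : Matrix (Fin n) (Fin n) K) : PowerSeries K :=
  ((1 + (X : K[X]) • A.map C).det : K[X])

theorem trace_exteriorPower_map {K V : Type*} [Field K] [AddCommGroup V] [Module K V]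
    {m : ℕ} (b : Module.Basis (Fin m) K V) (f : V →ₗ[K] V) (n : ℕ) :
    LinearMap.trace K (⋀[K]^n V) (exteriorPower.map n f) =
      PowerSeries.coeff n (detSeries (LinearMap.toMatrix b b f)) := by
  rw [LinearMap.trace_eq_matrix_trace K (b.exteriorPower n), detSeries, Polynomial.coeff_coe,
    Matrix.coeff_det_one_add_X_smul_eq_sum_minors, Matrix.trace]
  refine Finset.sum_bij (fun s _ => (s : Finset (Fin m))) ?_ ?_ ?_ ?_
  · intro s _
    have := s.2
    simp [Finset.mem_powersetCard]
  · intro s _ t _ h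
    exact Subtype.ext h
  · intro s hs
    exact ⟨⟨s, (Finset.mem_powersetCard.1 hs).2⟩, Finset.mem_univ _, rfl⟩
  · intro s _
    rw [Matrix.diag_apply, LinearMap.toMatrix_apply, exteriorPower.basis_apply,
      exteriorPower.map_apply_ιMulti_family, exteriorPower.basis_repr_apply,
      exteriorPower.ιMulti_family, exteriorPower.ιMultiDual_apply_ιMulti]
    have hs : (s : Finset (Fin m)).card = n := Set.powersetCard.card_eq s
    let e := (s : Finset (Fin m)).orderIsoOfFin hs
    rw [← Matrix.det_submatrix_equiv_self e.toEquiv, ← Matrix.det_transpose]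
    congr 1
    ext i j
    simp only [Matrix.transpose_apply, Matrix.of_apply, Matrix.submatrix_apply,
      LinearMap.toMatrix_apply, Module.Basis.coord_apply, Function.comp_apply]
    rfl

theorem eval_map_C_X {K : Type*} [CommRing K] (p : Polynomial K) :
    (p.map (PowerSeries.C (R := K))).eval PowerSeries.X = (p : PowerSeries K) := by
  rw [Polynomial.eval_map]
  have : Polynomial.eval₂RingHom (PowerSeries.C (R := K)) PowerSeries.X =
      Polynomial.coeToPowerSeries.ringHom := by
    ext <;> simp
  exact congrArg (fun φ => φ p) this

theorem derivative_detSeries {K : Type*} [Field K] {n : ℕ} (A : Matrix (Fin n) (Fin n) K) :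
    PowerSeries.derivative K (detSeries A) =
      detSeries A * PowerSeries.mk (fun k => (-1) ^ k * (A ^ (k + 1)).trace) := by
  let M : Matrix (Fin n) (Fin n) (PowerSeries K) := A.map PowerSeries.C
  let N : Matrix (Fin n) (Fin n) (PowerSeries K) :=
    Matrix.of fun i j => PowerSeries.mk fun k => (-1) ^ k * (A ^ k) i j
  have hMN : (1 + (PowerSeries.X : (PowerSeries K)) • M) * N = 1 := by
    rw [add_mul, one_mul]
    ext i j k
    rw [Matrix.add_apply, Matrix.smul_mul, Matrix.smul_apply, map_add, smul_eq_mul,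
      Matrix.mul_apply]
    cases k with
    | zero => simp [N, Matrix.one_apply]
    | succ k =>
      rw [PowerSeries.coeff_succ_X_mul, map_sum]
      simp only [M, N, Matrix.map_apply, Matrix.of_apply, PowerSeries.coeff_C_mul,
        PowerSeries.coeff_mk]
      have : (1 : Matrix (Fin n) (Fin n) (PowerSeries K)) i j = PowerSeries.C (if i = j then 1 else 0) := by
        rw [Matrix.one_apply]; split_ifs <;> simp
      rw [this, PowerSeries.coeff_C, if_neg (Nat.succ_ne_zero k), pow_succ' A, Matrix.mul_apply,
        Finset.mul_sum, ← Finset.sum_add_distrib]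
      refine Finset.sum_eq_zero fun l _ => ?_
      ring
  let D : Polynomial K := (1 + (Polynomial.X : Polynomial K) • A.map Polynomial.C).det
  have hD : ((D : Polynomial K) : PowerSeries K) = (1 + (PowerSeries.X : (PowerSeries K)) • M).det := by
    change Polynomial.coeToPowerSeries.ringHom D = _
    rw [RingHom.map_det]
    congr 1
    refine Matrix.ext fun i j => ?_
    by_cases h : i = j <;> simp [M, h, mul_comm PowerSeries.X]
  have hq : Polynomial.taylor (PowerSeries.X : (PowerSeries K)) (D.map PowerSeries.C) =
      Polynomial.C ((1 + (PowerSeries.X : (PowerSeries K)) • M).det) *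
        (1 + (Polynomial.X : Polynomial (PowerSeries K)) • (N * M).map Polynomial.C).det := by
    have h1 : D.map PowerSeries.C =
        (1 + (Polynomial.X : Polynomial (PowerSeries K)) • M.map Polynomial.C).det := by
      change Polynomial.mapRingHom _ D = _
      rw [RingHom.map_det]
      congr 1
      refine Matrix.ext fun i j => ?_
      by_cases h : i = j <;> simp [M, h]
    have h2 : Polynomial.taylor (PowerSeries.X : (PowerSeries K)) (D.map PowerSeries.C) =
        (1 + (Polynomial.X + Polynomial.C (PowerSeries.X : (PowerSeries K))) • M.map Polynomial.C).det := by
      rw [h1]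
      change Polynomial.taylorAlgHom (PowerSeries.X : (PowerSeries K)) _ = _
      rw [AlgHom.map_det]
      congr 1
      refine Matrix.ext fun i j => ?_
      by_cases h : i = j <;> simp [h] <;> exact mul_comm _ _
    have h3 : (1 + (Polynomial.X + Polynomial.C (PowerSeries.X : (PowerSeries K))) • M.map Polynomial.C) =
        (1 + (PowerSeries.X : (PowerSeries K)) • M).map Polynomial.C *
          (1 + (Polynomial.X : Polynomial (PowerSeries K)) • (N * M).map Polynomial.C) := by
      rw [mul_add, mul_one, Matrix.mul_smul, ← Matrix.map_mul, ← mul_assoc, hMN, one_mul]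
      refine Matrix.ext fun i j => ?_
      by_cases h : i = j <;> simp [h] <;> ring
    rw [h2, h3, Matrix.det_mul]
    congr 1
    exact (RingHom.map_det (Polynomial.C : (PowerSeries K) →+* Polynomial (PowerSeries K)) _).symm
  have hc := congrArg (fun p => Polynomial.coeff p 1) hq
  simp only [Polynomial.taylor_coeff_one, Polynomial.coeff_C_mul,
    Matrix.coeff_det_one_add_X_smul_one] at hc
  rw [Polynomial.derivative_map, eval_map_C_X, ← hD] at hc
  change PowerSeries.derivative K (D : PowerSeries K) = (D : PowerSeries K) * _
  rw [PowerSeries.derivative_coe, hc]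
  congr 1
  ext k
  rw [PowerSeries.coeff_mk, Matrix.trace, map_sum, Matrix.trace, Finset.mul_sum]
  refine Finset.sum_congr rfl fun i _ => ?_
  rw [Matrix.diag_apply, Matrix.mul_apply, map_sum, Matrix.diag_apply, pow_succ, Matrix.mul_apply,
    Finset.mul_sum]
  refine Finset.sum_congr rfl fun j _ => ?_
  simp [M, N, mul_assoc]

theorem constantCoeff_detSeries {K : Type*} [Field K] {n : ℕ} (A : Matrix (Fin n) (Fin n) K) :
    PowerSeries.constantCoeff (detSeries A) = 1 := by
  rw [detSeries, ← PowerSeries.coeff_zero_eq_constantCoeff_apply, Polynomial.coeff_coe,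
    Matrix.coeff_det_one_add_X_smul_eq_sum_minors]
  simp

theorem eq_of_logDeriv_eq {K : Type*} [Field K] [CharZero K] {F G P : PowerSeries K}
    (hF : PowerSeries.derivative K F = F * P) (hG : PowerSeries.derivative K G = G * P)
    (hF0 : PowerSeries.constantCoeff F = 1) (hG0 : PowerSeries.constantCoeff G = 1) : F = G := by
  have hG1 : PowerSeries.constantCoeff G ≠ 0 := by rw [hG0]; exact one_ne_zero
  have key : F * G⁻¹ = 1 := by
    apply PowerSeries.derivative.ext (R := K)
    · rw [Derivation.leibniz, PowerSeries.derivative_inv', hF, hG, smul_eq_mul, smul_eq_mul,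
        Derivation.map_one_eq_zero]
      linear_combination (-(F * G⁻¹ * P)) * PowerSeries.mul_inv_cancel G hG1
    · simp [hF0, hG0]
  calc F = F * (G⁻¹ * G) := by rw [PowerSeries.inv_mul_cancel G hG1, mul_one]
    _ = G := by rw [← mul_assoc, key, one_mul]

section CharacterRing

variable {K : Type*} [Field K] {G : Type*} [Group G]

/-- `f` is the character of a finite-dimensional representation of `G` over `K`. -/
def IsCharacter (K : Type*) [Field K] (G : Type*) [Group G] (f : G → K) : Prop :=
  ∃ (n : ℕ) (ρ : Representation K G (Fin n → K)), ρ.character = f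

theorem isCharacter_character {V : Type*} [AddCommGroup V] [Module K V] [FiniteDimensional K V]
    (ρ : Representation K G V) : IsCharacter K G ρ.character := by
  let e := (Module.finBasis K V).equivFun
  let σ : Representation K G (Fin (Module.finrank K V) → K) :=
    { toFun := fun g => e.conj (ρ g)
      map_one' := by rw [map_one]; exact LinearEquiv.conj_id e
      map_mul' := fun g h => by rw [map_mul]; exact LinearEquiv.conj_comp e _ _ }
  exact ⟨_, σ, funext fun g => LinearMap.trace_conj' (ρ g) e⟩

theorem IsCharacter.add {f g : G → K} (hf : IsCharacter K G f) (hg : IsCharacter K G g) :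
    IsCharacter K G (f + g) := by
  obtain ⟨n, ρ, rfl⟩ := hf
  obtain ⟨m, σ, rfl⟩ := hg
  have : (ρ.prod σ).character = ρ.character + σ.character :=
    funext fun x => LinearMap.trace_prodMap' (ρ x) (σ x)
  exact this ▸ isCharacter_character _

theorem IsCharacter.mul {f g : G → K} (hf : IsCharacter K G f) (hg : IsCharacter K G g) :
    IsCharacter K G (f * g) := by
  obtain ⟨n, ρ, rfl⟩ := hf
  obtain ⟨m, σ, rfl⟩ := hg
  exact Representation.char_tensor ρ σ ▸ isCharacter_character _

theorem isCharacter_zero : IsCharacter K G 0 :=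
  ⟨0, Representation.trivial K G _, funext fun g => by
    simp [Representation.character, Subsingleton.elim (Representation.trivial K G _ g) 0]⟩

theorem isCharacter_one : IsCharacter K G 1 := by
  have h := isCharacter_character (Representation.trivial K G K)
  have : (Representation.trivial K G K).character = 1 := funext fun g => by
    change LinearMap.trace K K 1 = 1
    simp
  exact this ▸ h

/-- The ring `R_K(G)` of virtual characters of `G` over `K`: all differences of characters of
finite-dimensional representations, with the pointwise operations (which correspond to direct sums
and tensor products of representations). -/
def CharRing (K : Type*) [Field K] (G : Type*) [Group G] : Subring (G → K) where
  carrier := {f | ∃ χ ψ : G → K, IsCharacter K G χ ∧ IsCharacter K G ψ ∧ f = χ - ψ}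
  zero_mem' := ⟨0, 0, isCharacter_zero, isCharacter_zero, by simp⟩
  one_mem' := ⟨1, 0, isCharacter_one, isCharacter_zero, by simp⟩
  add_mem' := by
    rintro _ _ ⟨a, b, ha, hb, rfl⟩ ⟨c, d, hc, hd, rfl⟩
    exact ⟨a + c, b + d, ha.add hc, hb.add hd, by ring⟩
  neg_mem' := by
    rintro _ ⟨a, b, ha, hb, rfl⟩
    exact ⟨b, a, hb, ha, by ring⟩
  mul_mem' := by
    rintro _ _ ⟨a, b, ha, hb, rfl⟩ ⟨c, d, hc, hd, rfl⟩
    exact ⟨a * c + b * d, a * d + b * c, (ha.mul hc).add (hb.mul hd), (ha.mul hd).add (hb.mul hc),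
      by ring⟩

/-- The character of a finite-dimensional representation as an element of `R_K(G)`. -/
def charOf {V : Type*} [AddCommGroup V] [Module K V] [FiniteDimensional K V]
    (ρ : Representation K G V) : CharRing K G :=
  ⟨ρ.character, ρ.character, 0, isCharacter_character ρ, isCharacter_zero, by simp⟩

theorem exists_eq_charOf_sub_charOf (x : CharRing K G) :
    ∃ p : (Σ n : ℕ, Representation K G (Fin n → K)) × (Σ n : ℕ, Representation K G (Fin n → K)),
      x = charOf p.1.2 - charOf p.2.2 := by
  obtain ⟨_, _, ⟨n, ρ, rfl⟩, ⟨m, σ, rfl⟩, h⟩ := x.2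
  exact ⟨(⟨n, ρ⟩, ⟨m, σ⟩), Subtype.ext h⟩

/-- The `n`-th exterior power of a representation. -/
def extPower {V : Type*} [AddCommGroup V] [Module K V] (n : ℕ) (ρ : Representation K G V) :
    Representation K G (⋀[K]^n V) where
  toFun g := exteriorPower.map n (ρ g)
  map_one' := by rw [map_one]; exact exteriorPower.map_id
  map_mul' g h := by rw [map_mul]; exact exteriorPower.map_comp _ _

/-- The power series `∑ₙ [Λⁿ V] tⁿ` with coefficients in `R_K(G)`. -/
def extSeries {V : Type*} [AddCommGroup V] [Module K V] [FiniteDimensional K V]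
    (ρ : Representation K G V) : PowerSeries (CharRing K G) :=
  PowerSeries.mk fun n => charOf (extPower n ρ)

/-- The `λ`-series `λ_t(x) = ∑ₙ λⁿ(x) tⁿ` of a virtual character: if `x = [V] - [W]` then
`λ_t(x) = (∑ₙ [Λⁿ V] tⁿ) / (∑ₙ [Λⁿ W] tⁿ)`. This does not depend on the choice of `V` and `W`,
see `lambdaSeries_mul_extSeries`. -/
def lambdaSeries (x : CharRing K G) : PowerSeries (CharRing K G) :=
  extSeries (exists_eq_charOf_sub_charOf x).choose.1.2 *
    PowerSeries.invOfUnit (extSeries (exists_eq_charOf_sub_charOf x).choose.2.2) 1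

/-- Evaluation of virtual characters at a group element. -/
def evalAt (g : G) : CharRing K G →+* K :=
  (Pi.evalRingHom (fun _ : G => K) g).comp (CharRing K G).subtype

theorem map_evalAt_extSeries {V : Type*} [AddCommGroup V] [Module K V] [FiniteDimensional K V]
    (ρ : Representation K G V) (g : G) :
    PowerSeries.map (evalAt g) (extSeries ρ) =
      detSeries (LinearMap.toMatrix (Module.finBasis K V) (Module.finBasis K V) (ρ g)) := by
  ext n
  rw [PowerSeries.coeff_map, extSeries, PowerSeries.coeff_mk, ← trace_exteriorPower_map]
  rfl

theorem powerSeries_ext {F F' : PowerSeries (CharRing K G)}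
    (h : ∀ g : G, PowerSeries.map (evalAt g) F = PowerSeries.map (evalAt g) F') : F = F' := by
  ext n g
  simpa [evalAt] using congrArg (PowerSeries.coeff n) (h g)

theorem constantCoeff_map_evalAt_extSeries {V : Type*} [AddCommGroup V] [Module K V]
    [FiniteDimensional K V] (ρ : Representation K G V) (g : G) :
    PowerSeries.constantCoeff (PowerSeries.map (evalAt g) (extSeries ρ)) = 1 := by
  rw [map_evalAt_extSeries, constantCoeff_detSeries]

theorem constantCoeff_extSeries {V : Type*} [AddCommGroup V] [Module K V]
    [FiniteDimensional K V] (ρ : Representation K G V) :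
    PowerSeries.constantCoeff (extSeries ρ) = 1 := by
  refine Subtype.ext <| funext fun g => ?_
  have h := constantCoeff_map_evalAt_extSeries ρ g
  rw [← PowerSeries.coeff_zero_eq_constantCoeff_apply, PowerSeries.coeff_map,
    PowerSeries.coeff_zero_eq_constantCoeff_apply] at h
  exact h

theorem derivative_map_evalAt_extSeries {V : Type*} [AddCommGroup V] [Module K V]
    [FiniteDimensional K V] (ρ : Representation K G V) (g : G) :
    PowerSeries.derivative K (PowerSeries.map (evalAt g) (extSeries ρ)) =
      PowerSeries.map (evalAt g) (extSeries ρ) *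
        PowerSeries.mk (fun k => (-1) ^ k * (charOf ρ : G → K) (g ^ (k + 1))) := by
  rw [map_evalAt_extSeries, derivative_detSeries]
  congr 2
  funext k
  rw [LinearMap.toMatrix_pow, ← LinearMap.trace_eq_matrix_trace, ← map_pow]
  rfl

section WellDefined

variable [CharZero K]

theorem extSeries_mul_eq {V₁ V₂ W₁ W₂ : Type*}
    [AddCommGroup V₁] [Module K V₁] [FiniteDimensional K V₁]
    [AddCommGroup V₂] [Module K V₂] [FiniteDimensional K V₂]
    [AddCommGroup W₁] [Module K W₁] [FiniteDimensional K W₁]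
    [AddCommGroup W₂] [Module K W₂] [FiniteDimensional K W₂]
    (ρ₁ : Representation K G V₁) (σ₁ : Representation K G W₁)
    (ρ₂ : Representation K G V₂) (σ₂ : Representation K G W₂)
    (h : charOf ρ₁ - charOf σ₁ = charOf ρ₂ - charOf σ₂) :
    extSeries ρ₁ * extSeries σ₂ = extSeries ρ₂ * extSeries σ₁ := by
  refine powerSeries_ext fun g => ?_
  rw [map_mul, map_mul]
  refine eq_of_logDeriv_eq
    (P := PowerSeries.mk fun k => (-1) ^ k * ((charOf ρ₁ + charOf σ₂ : CharRing K G) : G → K)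
      (g ^ (k + 1))) ?_ ?_ ?_ ?_
  · rw [Derivation.leibniz, derivative_map_evalAt_extSeries, derivative_map_evalAt_extSeries,
      smul_eq_mul, smul_eq_mul]
    have : (PowerSeries.mk fun k => (-1) ^ k * ((charOf ρ₁ + charOf σ₂ : CharRing K G) : G → K)
        (g ^ (k + 1))) = (PowerSeries.mk fun k => (-1) ^ k * (charOf ρ₁ : G → K) (g ^ (k + 1))) +
          PowerSeries.mk fun k => (-1) ^ k * (charOf σ₂ : G → K) (g ^ (k + 1)) := by
      ext k; simp [mul_add]
    rw [this]
    ring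
  · rw [sub_eq_sub_iff_add_eq_add.1 h, Derivation.leibniz, derivative_map_evalAt_extSeries,
      derivative_map_evalAt_extSeries, smul_eq_mul, smul_eq_mul]
    have : (PowerSeries.mk fun k => (-1) ^ k * ((charOf ρ₂ + charOf σ₁ : CharRing K G) : G → K)
        (g ^ (k + 1))) = (PowerSeries.mk fun k => (-1) ^ k * (charOf ρ₂ : G → K) (g ^ (k + 1))) +
          PowerSeries.mk fun k => (-1) ^ k * (charOf σ₁ : G → K) (g ^ (k + 1)) := by
      ext k; simp [mul_add]
    rw [this]
    ring
  · rw [map_mul, constantCoeff_map_evalAt_extSeries, constantCoeff_map_evalAt_extSeries, mul_one]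
  · rw [map_mul, constantCoeff_map_evalAt_extSeries, constantCoeff_map_evalAt_extSeries, mul_one]

/-- The `λ`-series of `[V] - [W]` is the quotient of the exterior power series of `V` and `W`,
whatever `V` and `W`. -/
theorem lambdaSeries_mul_extSeries {V W : Type*}
    [AddCommGroup V] [Module K V] [FiniteDimensional K V]
    [AddCommGroup W] [Module K W] [FiniteDimensional K W]
    (ρ : Representation K G V) (σ : Representation K G W) {x : CharRing K G}
    (h : x = charOf ρ - charOf σ) :
    lambdaSeries x * extSeries σ = extSeries ρ := by
  have hx := (exists_eq_charOf_sub_charOf x).choose_spec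
  have key := extSeries_mul_eq _ _ ρ σ (hx.symm.trans h)
  rw [lambdaSeries, mul_right_comm, key, mul_assoc, PowerSeries.mul_invOfUnit, mul_one]
  rw [constantCoeff_extSeries, Units.val_one]

end WellDefined

/-- The operation `λⁿ` on `R_K(G)`. -/
def lambdaOp (n : ℕ) (x : CharRing K G) : CharRing K G :=
  PowerSeries.coeff n (lambdaSeries x)

/-- On characters of representations, `λⁿ` is given by the exterior power. -/
theorem lambdaOp_charOf [CharZero K] {V : Type*} [AddCommGroup V] [Module K V]
    [FiniteDimensional K V] (n : ℕ) (ρ : Representation K G V) :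
    lambdaOp n (charOf ρ) = charOf (extPower n ρ) := by
  have h0 : charOf (Representation.trivial K G (Fin 0 → K)) = 0 :=
    Subtype.ext <| funext fun g => by
      change LinearMap.trace K _ _ = 0
      simp [Subsingleton.elim (Representation.trivial K G (Fin 0 → K) g) 0]
  have h := lambdaSeries_mul_extSeries ρ (Representation.trivial K G (Fin 0 → K))
    (x := charOf ρ) (by rw [h0, sub_zero])
  have h1 : extSeries (Representation.trivial K G (Fin 0 → K)) = 1 := by
    refine powerSeries_ext fun g => ?_
    refine eq_of_logDeriv_eq (derivative_map_evalAt_extSeries _ _) ?_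
      (constantCoeff_map_evalAt_extSeries _ _) (by simp)
    rw [h0]
    ext k
    simp
  rw [h1, mul_one] at h
  rw [lambdaOp, h, extSeries, PowerSeries.coeff_mk]

/-- The gamma operation `γⁿ(x) = λⁿ(x + n - 1)`. -/
def gammaOp (n : ℕ) (x : CharRing K G) : CharRing K G :=
  lambdaOp n (x + (n : CharRing K G) - 1)

section Functoriality

variable {H : Type*} [Group H]

/-- Restriction of virtual characters along a group homomorphism `φ : H → G`. -/
def pullback (φ : H →* G) : CharRing K G →+* CharRing K H where
  toFun x := ⟨fun h => (x : G → K) (φ h), by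
    obtain ⟨_, _, ⟨n, ρ, rfl⟩, ⟨m, σ, rfl⟩, h⟩ := x.2
    exact ⟨_, _, ⟨n, ρ.comp φ, rfl⟩, ⟨m, σ.comp φ, rfl⟩, by rw [h]; rfl⟩⟩
  map_one' := rfl
  map_mul' _ _ := rfl
  map_zero' := rfl
  map_add' _ _ := rfl

theorem map_pullback_extSeries {V : Type*} [AddCommGroup V] [Module K V] [FiniteDimensional K V]
    (φ : H →* G) (ρ : Representation K G V) :
    PowerSeries.map (pullback φ) (extSeries ρ) =
      extSeries (MonoidHom.comp ρ φ : Representation K H V) := by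
  ext n
  rw [PowerSeries.coeff_map, extSeries, extSeries, PowerSeries.coeff_mk, PowerSeries.coeff_mk]
  rfl

theorem pullback_lambdaOp [CharZero K] (φ : H →* G) (n : ℕ) (x : CharRing K G) :
    pullback φ (lambdaOp n x) = lambdaOp n (pullback φ x) := by
  obtain ⟨⟨⟨a, ρ⟩, ⟨b, σ⟩⟩, hx⟩ := exists_eq_charOf_sub_charOf x
  have h1 := congrArg (PowerSeries.map (pullback (K := K) φ)) (lambdaSeries_mul_extSeries ρ σ hx)
  rw [map_mul, map_pullback_extSeries, map_pullback_extSeries] at h1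
  have h2 := lambdaSeries_mul_extSeries (MonoidHom.comp ρ φ : Representation K H _)
    (MonoidHom.comp σ φ : Representation K H _) (x := pullback φ x)
    (by rw [hx, map_sub]; rfl)
  have hu : IsUnit (extSeries (MonoidHom.comp σ φ : Representation K H (Fin b → K))) := by
    rw [PowerSeries.isUnit_iff_constantCoeff, constantCoeff_extSeries]
    exact isUnit_one
  have h3 := hu.mul_right_cancel (h1.trans h2.symm)
  rw [lambdaOp, lambdaOp, ← h3, PowerSeries.coeff_map]

theorem pullback_gammaOp [CharZero K] (φ : H →* G) (n : ℕ) (x : CharRing K G) :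
    pullback φ (gammaOp n x) = gammaOp n (pullback φ x) := by
  rw [gammaOp, gammaOp, pullback_lambdaOp, map_sub, map_add, map_natCast, map_one]

end Functoriality

theorem evalAt_one_mem_range (x : CharRing K G) :
    evalAt 1 x ∈ (Int.castRingHom K).range := by
  obtain ⟨_, _, ⟨n, ρ, rfl⟩, ⟨m, σ, rfl⟩, h⟩ := x.2
  refine ⟨(n : ℤ) - m, ?_⟩
  change _ = (x : G → K) 1
  rw [h]
  simp

/-- The augmentation `ε : R_K(G) → ℤ`, which sends the character of a representation to its
degree, that is to its value at `1`. -/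
def augmentation [CharZero K] : CharRing K G →+* ℤ :=
  (RingEquiv.ofBijective (Int.castRingHom K).rangeRestrict
    ⟨fun _ _ h => Int.cast_injective (α := K) (congrArg Subtype.val h),
      (Int.castRingHom K).rangeRestrict_surjective⟩).symm.toRingHom.comp
    ((evalAt 1).codRestrict (Int.castRingHom K).range evalAt_one_mem_range)

theorem cast_augmentation [CharZero K] (x : CharRing K G) :
    ((augmentation x : ℤ) : K) = (x : G → K) 1 :=
  congrArg Subtype.val (RingEquiv.apply_symm_apply (RingEquiv.ofBijective
    (Int.castRingHom K).rangeRestrict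
    ⟨fun _ _ h => Int.cast_injective (α := K) (congrArg Subtype.val h),
      (Int.castRingHom K).rangeRestrict_surjective⟩) _)

theorem augmentation_pullback [CharZero K] {H : Type*} [Group H] (φ : H →* G) (x : CharRing K G) :
    augmentation (pullback φ x) = augmentation x := by
  apply Int.cast_injective (α := K)
  rw [cast_augmentation, cast_augmentation]
  change (x : G → K) (φ 1) = _
  rw [map_one]

end CharacterRing

section AssociatedGraded

/-- A decreasing multiplicative filtration of a commutative ring by additive subgroups. -/
structure RingFiltration (A : Type*) [CommRing A] where
  /-- The `n`-th step of the filtration. -/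
  step : ℕ → AddSubgroup A
  step_succ_le : ∀ n, step (n + 1) ≤ step n
  one_mem : 1 ∈ step 0
  mul_mem : ∀ {i j : ℕ} {a b : A}, a ∈ step i → b ∈ step j → a * b ∈ step (i + j)

variable {A : Type*} [CommRing A] (F : RingFiltration A)

/-- The quotient `Fⁿ / Fⁿ⁺¹`. -/
abbrev RingFiltration.Piece (n : ℕ) : Type _ :=
  F.step n ⧸ (F.step (n + 1)).addSubgroupOf (F.step n)

/-- The class in `Fⁿ / Fⁿ⁺¹` of an element of `Fⁿ`. -/
def RingFiltration.cls {n : ℕ} (a : A) (ha : a ∈ F.step n) : F.Piece n :=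
  QuotientAddGroup.mk ⟨a, ha⟩

theorem RingFiltration.cls_eq_iff {n : ℕ} {a b : A} (ha : a ∈ F.step n) (hb : b ∈ F.step n) :
    F.cls a ha = F.cls b hb ↔ b - a ∈ F.step (n + 1) := by
  rw [RingFiltration.cls, RingFiltration.cls, QuotientAddGroup.eq, AddSubgroup.mem_addSubgroupOf]
  simp [sub_eq_neg_add]

/-- The product `Fⁱ / Fⁱ⁺¹ × Fʲ / Fʲ⁺¹ → Fⁱ⁺ʲ / Fⁱ⁺ʲ⁺¹` induced by the product of the ring. -/
def RingFiltration.pieceMul {i j : ℕ} (x : F.Piece i) (y : F.Piece j) : F.Piece (i + j) :=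
  Quotient.liftOn₂ x y (fun a b => F.cls ((a : A) * b) (F.mul_mem a.2 b.2)) <| by
    rintro ⟨a, ha⟩ ⟨b, hb⟩ ⟨a', ha'⟩ ⟨b', hb'⟩ h h'
    have h1 : a' - a ∈ F.step (i + 1) := (F.cls_eq_iff ha ha').1 (Quotient.sound h)
    have h2 : b' - b ∈ F.step (j + 1) := (F.cls_eq_iff hb hb').1 (Quotient.sound h')
    rw [RingFiltration.cls_eq_iff]
    have e : a' * b' - a * b = (a' - a) * b' + a * (b' - b) := by ring
    have h3 : (a' - a) * b' ∈ F.step (i + j + 1) := by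
      have := F.mul_mem h1 hb'
      rwa [add_right_comm] at this
    rw [e]
    have h4 : a * (b' - b) ∈ F.step (i + j + 1) :=
      F.mul_mem (i := i) (j := j + 1) ha h2
    exact add_mem h3 h4

theorem RingFiltration.exists_cls {n : ℕ} (x : F.Piece n) : ∃ a ha, F.cls a ha = x := by
  induction x using QuotientAddGroup.induction_on with
  | H a => exact ⟨a, a.2, rfl⟩

theorem RingFiltration.mk_cls_eq {i j : ℕ} {a b : A} (ha : a ∈ F.step i) (hb : b ∈ F.step j)
    (hij : i = j) (hab : a = b) :
    GradedMonoid.mk (A := F.Piece) i (F.cls a ha) = GradedMonoid.mk j (F.cls b hb) := by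
  subst hij hab
  rfl

instance RingFiltration.gOne : GradedMonoid.GOne F.Piece where
  one := F.cls 1 F.one_mem

instance RingFiltration.gMul : GradedMonoid.GMul F.Piece where
  mul := F.pieceMul

instance RingFiltration.gCommRing : DirectSum.GCommRing F.Piece where
  mul_zero := by
    intro i j x
    obtain ⟨a, ha, rfl⟩ := F.exists_cls x
    exact (F.cls_eq_iff _ (zero_mem _)).2 (by simp)
  zero_mul := by
    intro i j x
    obtain ⟨a, ha, rfl⟩ := F.exists_cls x
    exact (F.cls_eq_iff _ (zero_mem _)).2 (by simp)
  mul_add := by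
    intro i j x y z
    obtain ⟨a, ha, rfl⟩ := F.exists_cls x
    obtain ⟨b, hb, rfl⟩ := F.exists_cls y
    obtain ⟨c, hc, rfl⟩ := F.exists_cls z
    exact (F.cls_eq_iff _ (add_mem (F.mul_mem ha hb) (F.mul_mem ha hc))).2 (by simp [mul_add])
  add_mul := by
    intro i j x y z
    obtain ⟨a, ha, rfl⟩ := F.exists_cls x
    obtain ⟨b, hb, rfl⟩ := F.exists_cls y
    obtain ⟨c, hc, rfl⟩ := F.exists_cls z
    exact (F.cls_eq_iff _ (add_mem (F.mul_mem ha hc) (F.mul_mem hb hc))).2 (by simp [add_mul])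
  one_mul := by
    rintro ⟨i, x⟩
    obtain ⟨a, ha, rfl⟩ := F.exists_cls x
    exact F.mk_cls_eq _ _ (zero_add i) (one_mul a)
  mul_one := by
    rintro ⟨i, x⟩
    obtain ⟨a, ha, rfl⟩ := F.exists_cls x
    exact F.mk_cls_eq _ _ (add_zero i) (mul_one a)
  mul_assoc := by
    rintro ⟨i, x⟩ ⟨j, y⟩ ⟨k, z⟩
    obtain ⟨a, ha, rfl⟩ := F.exists_cls x
    obtain ⟨b, hb, rfl⟩ := F.exists_cls y
    obtain ⟨c, hc, rfl⟩ := F.exists_cls z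
    exact F.mk_cls_eq _ _ (add_assoc i j k) (mul_assoc a b c)
  mul_comm := by
    rintro ⟨i, x⟩ ⟨j, y⟩
    obtain ⟨a, ha, rfl⟩ := F.exists_cls x
    obtain ⟨b, hb, rfl⟩ := F.exists_cls y
    exact F.mk_cls_eq _ _ (add_comm i j) (mul_comm a b)
  natCast n := n • F.cls 1 F.one_mem
  natCast_zero := zero_nsmul _
  natCast_succ n := succ_nsmul _ n
  intCast n := n • F.cls 1 F.one_mem
  intCast_ofNat n := natCast_zsmul _ n
  intCast_negSucc_ofNat n := negSucc_zsmul _ n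

/-- The associated graded ring `⨁ₙ Fⁿ / Fⁿ⁺¹`. -/
abbrev RingFiltration.Graded : Type _ := DirectSum ℕ F.Piece

/-- The additive map of associated graded groups induced by a map preserving the filtrations. -/
def RingFiltration.gradedMap {A : Type*} [CommRing A] {F : RingFiltration A} {B : Type*} [CommRing B] {F' : RingFiltration B} (φ : A →+* B)
    (h : ∀ n, ∀ a ∈ F.step n, φ a ∈ F'.step n) : F.Graded →+ F'.Graded :=
  DirectSum.map fun n =>
    QuotientAddGroup.map _ _
      ((φ.toAddMonoidHom.comp (F.step n).subtype).codRestrict (F'.step n) fun a => h n a a.2)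
      fun a ha => h (n + 1) a ha

end AssociatedGraded

section GradedCharacterRing

variable {K : Type*} [Field K] [CharZero K] {G : Type*} [Group G]

/-- The monomials `γ^{n₁}(x₁) ⋯ γ^{n_k}(x_k)` with all `xᵢ` in the augmentation ideal and
`n₁ + ⋯ + n_k ≥ n`. -/
def gammaMonomials (K : Type*) [Field K] [CharZero K] (G : Type*) [Group G] (n : ℕ) :
    Set (CharRing K G) :=
  {m | ∃ l : List (ℕ × CharRing K G), (∀ p ∈ l, p.2 ∈ RingHom.ker (augmentation (K := K) (G := G)))
    ∧ n ≤ (l.map Prod.fst).sum ∧ m = (l.map fun p => gammaOp p.1 p.2).prod}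

/-- The Grothendieck filtration on `R_K(G)`. -/
def gammaFiltration (K : Type*) [Field K] [CharZero K] (G : Type*) [Group G] :
    RingFiltration (CharRing K G) where
  step n := AddSubgroup.closure (gammaMonomials K G n)
  step_succ_le n := AddSubgroup.closure_mono <| by
    rintro m ⟨l, h1, h2, h3⟩
    exact ⟨l, h1, (Nat.le_succ n).trans h2, h3⟩
  one_mem := AddSubgroup.subset_closure ⟨[], by simp, by simp, by simp⟩
  mul_mem := by
    intro i j a b ha hb
    induction ha using AddSubgroup.closure_induction with
    | zero => rw [zero_mul]; exact zero_mem _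
    | add x y _ _ hx hy => rw [add_mul]; exact add_mem hx hy
    | neg x _ hx => rw [neg_mul]; exact neg_mem hx
    | mem x hx =>
      induction hb using AddSubgroup.closure_induction with
      | zero => rw [mul_zero]; exact zero_mem _
      | add y z _ _ hy hz => rw [mul_add]; exact add_mem hy hz
      | neg y _ hy => rw [mul_neg]; exact neg_mem hy
      | mem y hy =>
        obtain ⟨l, h1, h2, rfl⟩ := hx
        obtain ⟨l', h1', h2', rfl⟩ := hy
        refine AddSubgroup.subset_closure ⟨l ++ l', ?_, ?_, ?_⟩
        · intro p hp
          exact (List.mem_append.1 hp).elim (h1 p) (h1' p)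
        · rw [List.map_append, List.sum_append]
          exact add_le_add h2 h2'
        · rw [List.map_append, List.prod_append]

/-- The graded character ring `R*_K(G) = ⨁ₙ Γⁿ / Γⁿ⁺¹`. -/
abbrev GradedCharRing (K : Type*) [Field K] [CharZero K] (G : Type*) [Group G] : Type _ :=
  (gammaFiltration K G).Graded

theorem pullback_mem_step {H : Type*} [Group H] (φ : H →* G) (n : ℕ) (x : CharRing K G)
    (hx : x ∈ (gammaFiltration K G).step n) : pullback φ x ∈ (gammaFiltration K H).step n := by
  induction hx using AddSubgroup.closure_induction with
  | zero => rw [map_zero]; exact zero_mem _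
  | add x y _ _ hx hy => rw [map_add]; exact add_mem hx hy
  | neg x _ hx => rw [map_neg]; exact neg_mem hx
  | mem x hx =>
    obtain ⟨l, h1, h2, rfl⟩ := hx
    refine AddSubgroup.subset_closure ⟨l.map fun p => (p.1, pullback φ p.2), ?_, ?_, ?_⟩
    · intro p hp
      obtain ⟨q, hq, rfl⟩ := List.mem_map.1 hp
      have := h1 q hq
      rw [RingHom.mem_ker] at this ⊢
      rw [augmentation_pullback, this]
    · rw [List.map_map]; exact h2
    · rw [map_list_prod, List.map_map, List.map_map]
      congr 1
      exact List.map_congr_left fun p _ => pullback_gammaOp φ _ _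

/-- The map `R*_K(G) → R*_K(H)` induced by a group homomorphism `H → G`. -/
def gradedPullback (K : Type*) [Field K] [CharZero K] {G H : Type*} [Group G] [Group H]
    (φ : H →* G) : GradedCharRing K G →+ GradedCharRing K H :=
  RingFiltration.gradedMap (pullback φ) (pullback_mem_step φ)

theorem gammaOp_mem_step (n : ℕ) (x : CharRing K G) :
    gammaOp n (x - (augmentation x : CharRing K G)) ∈ (gammaFiltration K G).step n := by
  refine AddSubgroup.subset_closure ⟨[(n, x - (augmentation x : CharRing K G))], ?_, ?_, ?_⟩
  · simp [RingHom.mem_ker]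
  · simp
  · simp

/-- The `n`-th algebraic Chern class of `x`: the class in degree `n` of `γⁿ(x - ε(x))`. -/
def chernClass (n : ℕ) (x : CharRing K G) : GradedCharRing K G :=
  DirectSum.of (gammaFiltration K G).Piece n ((gammaFiltration K G).cls _ (gammaOp_mem_step n x))

end GradedCharacterRing

section Mackey

/-- The conjugate subgroup `ᵍH = gHg⁻¹`. -/
def conjSubgroup {G : Type*} [Group G] (g : G) (H : Subgroup G) : Subgroup G :=
  H.map (MulAut.conj g).toMonoidHom

theorem mem_conjSubgroup {G : Type*} [Group G] {g : G} {H : Subgroup G} {x : G} :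
    x ∈ conjSubgroup g H ↔ g⁻¹ * x * g ∈ H := by
  rw [conjSubgroup, Subgroup.mem_map]
  constructor
  · rintro ⟨h, hh, rfl⟩
    simpa [mul_assoc] using hh
  · intro h
    exact ⟨_, h, by simp [mul_assoc]⟩

theorem inf_conjSubgroup {G : Type*} [Group G] (g : G) (J K : Subgroup G) :
    J ⊓ conjSubgroup g K = conjSubgroup g (conjSubgroup g⁻¹ J ⊓ K) := by
  ext x
  simp [mem_conjSubgroup, mul_assoc]

theorem conjSubgroup_of_mem_normalizer {G : Type*} [Group G] {g : G} {H : Subgroup G}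
    (hg : g ∈ Subgroup.normalizer (H : Set G)) : H = conjSubgroup g H := by
  ext x
  rw [mem_conjSubgroup]
  have := Subgroup.mem_normalizer_iff.1 (inv_mem hg) x
  simpa using this

/-- `T` is a set of representatives of the double cosets `J \ H / K`. -/
def IsDoubleCosetReps {G : Type*} [Group G] (H J K : Subgroup G) (T : Finset G) : Prop :=
  (∀ x ∈ T, x ∈ H) ∧ ∀ h ∈ H, ∃! x, x ∈ T ∧ ∃ j ∈ J, ∃ k ∈ K, h = j * x * k

/-- The axioms of a (`ℤ`-valued) Mackey functor for the group `G`: `S` assigns an abelian group to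
every subgroup of `G`, with restrictions `res : S(H) → S(K)` and inductions `ind : S(K) → S(H)` for
`K ≤ H`, and conjugations `c_g : S(H) → S(ᵍH)` (here the target is any `K` with `K = ᵍH`, so that
no transport along equalities of subgroups is needed). -/
structure IsMackeyFunctor {G : Type*} [Group G] (S : Subgroup G → Type*)
    [∀ H, AddCommGroup (S H)]
    (res : ∀ {K H : Subgroup G}, K ≤ H → S H →+ S K)
    (ind : ∀ {K H : Subgroup G}, K ≤ H → S K →+ S H)
    (conj : ∀ (g : G) {H K : Subgroup G}, K = conjSubgroup g H → S H →+ S K) : Prop where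
  res_self : ∀ (H : Subgroup G) (z : S H), res le_rfl z = z
  ind_self : ∀ (H : Subgroup G) (z : S H), ind le_rfl z = z
  conj_self : ∀ (H : Subgroup G) (h : G) (e : H = conjSubgroup h H), h ∈ H →
    ∀ z : S H, conj h e z = z
  res_res : ∀ {J K H : Subgroup G} (hJK : J ≤ K) (hKH : K ≤ H) (z : S H),
    res hJK (res hKH z) = res (hJK.trans hKH) z
  ind_ind : ∀ {J K H : Subgroup G} (hJK : J ≤ K) (hKH : K ≤ H) (z : S J),
    ind hKH (ind hJK z) = ind (hJK.trans hKH) z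
  conj_conj : ∀ (g h : G) {H K L : Subgroup G} (eK : K = conjSubgroup h H)
    (eL : L = conjSubgroup g K) (eL' : L = conjSubgroup (g * h) H) (z : S H),
    conj g eL (conj h eK z) = conj (g * h) eL' z
  res_conj : ∀ (g : G) {K H K' H' : Subgroup G} (hKH : K ≤ H) (hKH' : K' ≤ H')
    (eK : K' = conjSubgroup g K) (eH : H' = conjSubgroup g H) (z : S H),
    res hKH' (conj g eH z) = conj g eK (res hKH z)
  ind_conj : ∀ (g : G) {K H K' H' : Subgroup G} (hKH : K ≤ H) (hKH' : K' ≤ H')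
    (eK : K' = conjSubgroup g K) (eH : H' = conjSubgroup g H) (z : S K),
    ind hKH' (conj g eK z) = conj g eH (ind hKH z)
  /-- The Mackey formula: `res_J ind_K = ∑ₓ ind_{J ∩ ˣK} c_x res_{Jˣ ∩ K}`, the sum being over
  representatives of `J \ H / K`. -/
  mackey : ∀ {J K H : Subgroup G} (hJ : J ≤ H) (hK : K ≤ H) (T : Finset G),
    IsDoubleCosetReps H J K T → ∀ z : S K,
      res hJ (ind hK z) = ∑ x ∈ T,
        ind (inf_le_left : J ⊓ conjSubgroup x K ≤ J)
          (conj x (inf_conjSubgroup x J K)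
            (res (inf_le_right : conjSubgroup x⁻¹ J ⊓ K ≤ K) z))

variable (K : Type*) [Field K] [CharZero K] {G : Type*} [Group G]

/-- Restriction `R*_K(H) → R*_K(L)` for subgroups `L ≤ H`. -/
def gradedRes {L H : Subgroup G} (h : L ≤ H) : GradedCharRing K H →+ GradedCharRing K L :=
  gradedPullback K (Subgroup.inclusion h)

/-- The homomorphism `x ↦ g⁻¹xg` from `L = ᵍH` to `H`. -/
def conjHom (g : G) {H L : Subgroup G} (e : L = conjSubgroup g H) : L →* H :=
  ((MulAut.conj g⁻¹).toMonoidHom.comp L.subtype).codRestrict H fun x => by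
    have hx : (x : G) ∈ conjSubgroup g H := e.le x.2
    simpa using mem_conjSubgroup.1 hx

/-- Conjugation `c_g : R*_K(H) → R*_K(ᵍH)`, induced by `(c_g χ)(x) = χ(g⁻¹xg)`. -/
def gradedConj (g : G) {H L : Subgroup G} (e : L = conjSubgroup g H) :
    GradedCharRing K H →+ GradedCharRing K L :=
  gradedPullback K (conjHom g e)

end Mackey

section AlternatingGroup

/-- The alternating group `A₄`. -/
abbrev A4 : Type := alternatingGroup (Fin 4)

/-- The `3`-cycle `(1 2 3)`. -/
def cycle123 : A4 := ⟨c[0, 1, 2], by rw [Equiv.Perm.mem_alternatingGroup]; decide⟩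

/-- The double transposition `(1 2)(3 4)`. -/
def swap12swap34 : A4 := ⟨c[0, 1] * c[2, 3], by rw [Equiv.Perm.mem_alternatingGroup]; decide⟩

/-- The class in `R_ℂ(A₄)` of the standard representation, the quotient of the permutation
representation on `ℂ⁴` by the trivial representation. -/
def standardChar : CharRing ℂ A4 :=
  charOf (Representation.ofMulAction ℂ A4 (Fin 4)) - 1

end AlternatingGroup

end

end GradedCharacterRing

/-! Everything rests on bounding the Grothendieck filtration from above. Since `γ_t(x) = ∑ γⁿ(x) tⁿ`
turns sums into products, a multiplicative filtration contains `Γ` as soon as it contains the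
`γⁿ(x)` for `x` in a generating set of the augmentation ideal (`gammaFiltration_le`). For `A₄` the
generators are `ρ - 1`, `ρ² - 1` and `θ - 3`, with `γ_t(ρⁱ - 1) = 1 + (ρⁱ - 1)t` and `γ_t(θ - 3) = 1
+ (θ - 3)t + (3 - θ)t²`. So only `ρ - 1` and `ρ² - 1` in weight one and `3 - θ` in weight two matter
(`a4_gammaFiltration_le`). Evaluating at group elements then gives divisibility: on `Γⁿ`, values at
involutions of `A₄` are multiples of `4^⌈n/2⌉`, and values at `(1 2 3)` are multiples of `(ω - 1)ⁿ`
in the Eisenstein integers.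

Parts 1 and 2 have one obstruction. In the Klein four-group take two independent sign characters,
put `a = χ₁ - 1`, `b = χ₂ - 1` and `w = a³ + b³ - a²b ∈ Γ³`. It takes the value `-8` at each of the
three involutions, so its class is fixed by conjugation. An element of `Γ³` of `A₄` has values in
`16ℤ` at involutions, and so has an element of `Γ⁴` of the Klein group, because restriction to `C₂`
gives divisibility by `2ⁿ`. Hence no odd multiple of `[w]` is a restriction
(`kleinFour_image_obstruction`). With `m = 1` this is the strict inclusion. In a Mackey functor, the
formula for the normal Klein subgroup of index three gives `res (ind [w]) = 3[w]`, which is excluded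
in the same way.

For part 3, the relations come from `(ρ - 1)(3 - θ) = 3(ρ - 1)` and `(3 - θ)² = 4(3 - θ) + 3(ρ - 1)
+ (ρ - 1)²`. Surjectivity is the principle `gammaFiltration_le` applied to the elements whose symbol
lies in the range. For injectivity, `x² = -4y` reduces every element to `A(y) + xB(y)`. The degrees
separate the coefficients, and the divisibility bounds show that the orders of `yᵏ` (`k ≥ 1`) and
`xyᵏ` are no smaller than `12` and `3`. -/

namespace GradedCharacterRing

noncomputable section

/-! ### Logarithmic derivative and additivity of the `λ`-series -/

section LambdaSeries

variable {K : Type*} [Field K] [CharZero K] {G : Type*} [Group G]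

/-- Logarithmic derivatives of quotients subtract, so the formula for exterior power series extends
to virtual characters. With constant term `1`, it determines the `λ`-series from the values `x(gᵏ)`,
which is how all `λ`-series below are computed. -/
theorem derivative_map_evalAt_lambdaSeries (x : CharRing K G) (g : G) :
    PowerSeries.derivative K (PowerSeries.map (evalAt g) (lambdaSeries x)) =
      PowerSeries.map (evalAt g) (lambdaSeries x) *
        PowerSeries.mk (fun k => (-1) ^ k * (x : G → K) (g ^ (k + 1))) := by
  obtain ⟨⟨⟨a, ρ⟩, ⟨b, σ⟩⟩, hx⟩ := exists_eq_charOf_sub_charOf x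
  have h := congrArg (PowerSeries.map (evalAt g)) (lambdaSeries_mul_extSeries ρ σ hx)
  rw [map_mul] at h
  have hσ := derivative_map_evalAt_extSeries σ g
  have hρ := derivative_map_evalAt_extSeries ρ g
  have hne : PowerSeries.map (evalAt g) (extSeries σ) ≠ 0 := fun h0 => by
    have := constantCoeff_map_evalAt_extSeries σ g
    rw [h0, map_zero] at this
    exact zero_ne_one this
  have hsplit : (PowerSeries.mk fun k => (-1) ^ k * (x : G → K) (g ^ (k + 1))) =
      (PowerSeries.mk fun k => (-1) ^ k * (charOf ρ : G → K) (g ^ (k + 1))) -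
        PowerSeries.mk fun k => (-1) ^ k * (charOf σ : G → K) (g ^ (k + 1)) := by
    ext k
    simp [hx, mul_sub]
  rw [← h, Derivation.leibniz, smul_eq_mul, smul_eq_mul, hσ] at hρ
  apply mul_right_cancel₀ hne
  rw [hsplit]
  linear_combination hρ

theorem constantCoeff_lambdaSeries (x : CharRing K G) :
    PowerSeries.constantCoeff (lambdaSeries x) = 1 := by
  obtain ⟨⟨⟨a, ρ⟩, ⟨b, σ⟩⟩, hx⟩ := exists_eq_charOf_sub_charOf x
  have h := congrArg PowerSeries.constantCoeff (lambdaSeries_mul_extSeries ρ σ hx)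
  rwa [map_mul, constantCoeff_extSeries, constantCoeff_extSeries, mul_one] at h

theorem constantCoeff_map_evalAt_lambdaSeries (x : CharRing K G) (g : G) :
    PowerSeries.constantCoeff (PowerSeries.map (evalAt g) (lambdaSeries x)) = 1 := by
  rw [← PowerSeries.coeff_zero_eq_constantCoeff_apply, PowerSeries.coeff_map,
    PowerSeries.coeff_zero_eq_constantCoeff_apply, constantCoeff_lambdaSeries, map_one]

theorem lambdaSeries_add (x y : CharRing K G) :
    lambdaSeries (x + y) = lambdaSeries x * lambdaSeries y := by
  refine powerSeries_ext fun g => ?_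
  refine eq_of_logDeriv_eq (derivative_map_evalAt_lambdaSeries _ g) ?_
    (constantCoeff_map_evalAt_lambdaSeries _ g) ?_
  · have hsplit : (PowerSeries.mk fun k => (-1) ^ k * ((x + y : CharRing K G) : G → K)
        (g ^ (k + 1))) = (PowerSeries.mk fun k => (-1) ^ k * (x : G → K) (g ^ (k + 1))) +
          PowerSeries.mk fun k => (-1) ^ k * (y : G → K) (g ^ (k + 1)) := by
      ext k
      simp [mul_add]
    rw [map_mul, Derivation.leibniz, derivative_map_evalAt_lambdaSeries,
      derivative_map_evalAt_lambdaSeries, smul_eq_mul, smul_eq_mul, hsplit]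
    ring
  · rw [map_mul, map_mul, constantCoeff_map_evalAt_lambdaSeries,
      constantCoeff_map_evalAt_lambdaSeries, mul_one]

theorem derivative_list_prod_one_add (l : List K) :
    PowerSeries.derivative K (l.map fun a => 1 + PowerSeries.C a * PowerSeries.X).prod =
      (l.map fun a => 1 + PowerSeries.C a * PowerSeries.X).prod *
        PowerSeries.mk (fun k => (-1) ^ k * (l.map fun a => a ^ (k + 1)).sum) := by
  induction l with
  | nil =>
    rw [List.map_nil, List.prod_nil, Derivation.map_one_eq_zero, one_mul]
    ext k
    simp
  | cons a l ih =>
    have h1 : PowerSeries.derivative K (1 + PowerSeries.C a * PowerSeries.X) =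
        (1 + PowerSeries.C a * PowerSeries.X) *
          PowerSeries.mk (fun k => (-1) ^ k * a ^ (k + 1)) := by
      ext k
      rw [PowerSeries.coeff_derivative, add_mul, one_mul, mul_assoc, map_add, map_add,
        PowerSeries.coeff_C_mul, PowerSeries.coeff_C_mul]
      cases k with
      | zero => simp [PowerSeries.coeff_one, PowerSeries.coeff_X]
      | succ k =>
        rw [PowerSeries.coeff_succ_X_mul]
        simp [PowerSeries.coeff_one, PowerSeries.coeff_X]
        ring
    have h2 : (PowerSeries.mk fun k => (-1) ^ k * ((a :: l).map fun b => b ^ (k + 1)).sum) =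
        (PowerSeries.mk fun k => (-1) ^ k * a ^ (k + 1)) +
          PowerSeries.mk fun k => (-1) ^ k * (l.map fun b => b ^ (k + 1)).sum := by
      ext k
      simp [mul_add]
    rw [List.map_cons, List.prod_cons, Derivation.leibniz, smul_eq_mul, smul_eq_mul, ih, h1, h2]
    ring

/-- If `x(gᵏ) = ∑ aᵢᵏ` for all `k ≥ 1` then `λ_t(x)(g) = ∏ (1 + aᵢ t)`. -/
theorem map_evalAt_lambdaSeries_eq_prod (x : CharRing K G) (g : G) (l : List K)
    (h : ∀ k : ℕ, (x : G → K) (g ^ (k + 1)) = (l.map fun a => a ^ (k + 1)).sum) :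
    PowerSeries.map (evalAt g) (lambdaSeries x) =
      (l.map fun a => 1 + PowerSeries.C a * PowerSeries.X).prod := by
  refine eq_of_logDeriv_eq (derivative_map_evalAt_lambdaSeries x g) ?_
    (constantCoeff_map_evalAt_lambdaSeries x g) ?_
  · rw [derivative_list_prod_one_add]
    simp only [h]
  · rw [map_list_prod, List.map_map]
    apply List.prod_eq_one
    simp

theorem lambdaSeries_of_isMultiplicative (x : CharRing K G)
    (h : ∀ (g : G) (k : ℕ), (x : G → K) (g ^ (k + 1)) = (x : G → K) g ^ (k + 1)) :
    lambdaSeries x = 1 + PowerSeries.C x * PowerSeries.X := by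
  refine powerSeries_ext fun g => ?_
  rw [map_evalAt_lambdaSeries_eq_prod x g [(x : G → K) g] (by simpa using h g)]
  simp [evalAt]

theorem lambdaSeries_one : lambdaSeries (1 : CharRing K G) = 1 + PowerSeries.X := by
  rw [lambdaSeries_of_isMultiplicative _ (by simp)]
  simp

theorem lambdaSeries_natCast (n : ℕ) :
    lambdaSeries (n : CharRing K G) = (1 + PowerSeries.X) ^ n := by
  induction n with
  | zero =>
    have h := lambdaSeries_add (0 : CharRing K G) 1
    rw [zero_add, lambdaSeries_one] at h
    have hu : IsUnit (1 + PowerSeries.X : PowerSeries (CharRing K G)) := by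
      simp [PowerSeries.isUnit_iff_constantCoeff]
    rw [Nat.cast_zero, pow_zero]
    exact hu.mul_right_cancel (by rw [← h, one_mul])
  | succ n ih => rw [Nat.cast_succ, lambdaSeries_add, ih, lambdaSeries_one, pow_succ]

end LambdaSeries

/-! ### The `γ`-series as `λ_{t/(1-t)}` -/

section GammaSeries

open PowerSeries in
theorem hasSubst_X_mul_mk_one {A : Type*} [CommRing A] :
    PowerSeries.HasSubst (X * PowerSeries.mk 1 : PowerSeries A) :=
  HasSubst.of_constantCoeff_zero' (by simp)

open PowerSeries in
-- `X * PowerSeries.mk 1` is `t/(1-t)`, and the coefficient of `tⁿ⁺¹` in `(t/(1-t))ᵈ` is `n.choose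
-- (d - 1)` for `d ≥ 1`, which is the coefficient of `tⁿ⁺¹⁻ᵈ` in `(1+t)ⁿ` when `d ≤ n + 1`.
theorem coeff_subst_X_mul_mk_one {A : Type*} [CommRing A] (F : PowerSeries A) (n : ℕ) :
    coeff (n + 1) (F.subst (X * PowerSeries.mk 1 : PowerSeries A)) =
      coeff (n + 1) (F * (1 + X) ^ n) := by
  rw [coeff_subst' hasSubst_X_mul_mk_one, coeff_mul,
    Finset.Nat.sum_antidiagonal_eq_sum_range_succ_mk,
    finsum_eq_sum_of_support_subset (s := Finset.range (n + 1 + 1))]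
  · refine Finset.sum_congr rfl fun d hd => ?_
    rw [smul_eq_mul]
    congr 1
    have hd' := Finset.mem_range.1 hd
    have h2 : (1 + X : PowerSeries A) ^ n =
        (((1 + Polynomial.X) ^ n : Polynomial A) : PowerSeries A) := by
      simp
    rw [h2, Polynomial.coeff_coe, Polynomial.coeff_one_add_X_pow, mul_pow]
    cases d with
    | zero => simp [coeff_one]
    | succ d =>
      obtain ⟨m, rfl⟩ : ∃ m, n = d + m := ⟨n - d, by omega⟩
      rw [show d + m + 1 = m + (d + 1) by ring, coeff_X_pow_mul, mk_one_pow_eq_mk_choose_add,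
        coeff_mk, Nat.add_sub_cancel, Nat.choose_symm_add]
  · intro d hd
    by_contra hn
    apply hd
    have hn' : n + 1 < d := by simpa using hn
    dsimp only
    rw [mul_pow, coeff_X_pow_mul', if_neg (by omega), smul_zero]

variable {K : Type*} [Field K] [CharZero K] {G : Type*} [Group G]

/-- The `γ`-series `γ_t(x) = ∑ₙ γⁿ(x) tⁿ`. -/
def gammaSeries (x : CharRing K G) : PowerSeries (CharRing K G) :=
  PowerSeries.mk fun n => gammaOp n x

theorem gammaOp_zero (x : CharRing K G) : gammaOp 0 x = 1 := by
  rw [gammaOp, lambdaOp, PowerSeries.coeff_zero_eq_constantCoeff_apply, constantCoeff_lambdaSeries]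

open PowerSeries in
-- The shift in `γⁿ⁺¹(x) = λⁿ⁺¹(x + n)` multiplies the `λ`-series by `(1+t)ⁿ`, which has the same
-- effect on this coefficient as substituting `t/(1-t)`. Multiplicativity of the `γ`-series then
-- follows from that of the `λ`-series.
theorem gammaSeries_eq_subst (x : CharRing K G) :
    gammaSeries x = (lambdaSeries x).subst (X * PowerSeries.mk 1 : PowerSeries (CharRing K G)) := by
  ext1 n
  rw [gammaSeries, coeff_mk]
  cases n with
  | zero =>
    rw [gammaOp_zero, coeff_subst' hasSubst_X_mul_mk_one, finsum_eq_single _ 0]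
    · simp [constantCoeff_lambdaSeries]
    · intro d hd
      simp [hd]
  | succ n =>
    rw [coeff_subst_X_mul_mk_one, gammaOp, lambdaOp, Nat.cast_succ, ← add_assoc,
      add_sub_cancel_right, lambdaSeries_add, lambdaSeries_natCast]

theorem gammaSeries_add (x y : CharRing K G) :
    gammaSeries (x + y) = gammaSeries x * gammaSeries y := by
  rw [gammaSeries_eq_subst, gammaSeries_eq_subst, gammaSeries_eq_subst, lambdaSeries_add,
    PowerSeries.subst_mul hasSubst_X_mul_mk_one]

theorem gammaOp_add (n : ℕ) (x y : CharRing K G) :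
    gammaOp n (x + y) =
      ∑ p ∈ Finset.HasAntidiagonal.antidiagonal n, gammaOp p.1 x * gammaOp p.2 y := by
  have h := congrArg (PowerSeries.coeff n) (gammaSeries_add x y)
  simpa only [PowerSeries.coeff_mul, gammaSeries, PowerSeries.coeff_mk] using h

theorem gammaOp_zero_right (n : ℕ) : gammaOp (n + 1) (0 : CharRing K G) = 0 := by
  rw [gammaOp, lambdaOp, zero_add, Nat.cast_succ, add_sub_cancel_right, lambdaSeries_natCast]
  have h2 : (1 + PowerSeries.X : PowerSeries (CharRing K G)) ^ n =
      (((1 + Polynomial.X) ^ n : Polynomial (CharRing K G)) : PowerSeries (CharRing K G)) := by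
    simp
  rw [h2, Polynomial.coeff_coe, Polynomial.coeff_one_add_X_pow]
  simp

open PowerSeries in
/-- If `λ_t(x + d) = ∑_{i ≤ d} aᵢ tⁱ` then `γ_t(x) = ∑_{i ≤ d} aᵢ tⁱ (1 - t)ᵈ⁻ⁱ`. -/
theorem gammaSeries_eq_of_lambdaSeries (x : CharRing K G) (d : ℕ) (a : ℕ → CharRing K G)
    (h : lambdaSeries (x + (d : CharRing K G)) = ∑ i ∈ Finset.range (d + 1), C (a i) * X ^ i) :
    gammaSeries x = ∑ i ∈ Finset.range (d + 1), C (a i) * X ^ i * (1 - X) ^ (d - i) := by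
  have hS : HasSubst (X * PowerSeries.mk 1 : PowerSeries (CharRing K G)) := hasSubst_X_mul_mk_one
  have hm : (PowerSeries.mk 1 : PowerSeries (CharRing K G)) * (1 - X) = 1 :=
    mk_one_mul_one_sub_eq_one _
  rw [lambdaSeries_add, lambdaSeries_natCast] at h
  have h' := congrArg (substAlgHom (R := CharRing K G) hS) h
  have hX : substAlgHom (R := CharRing K G) hS X = X * PowerSeries.mk 1 := substAlgHom_X hS
  have hC : ∀ r : CharRing K G, substAlgHom (R := CharRing K G) hS (C r) = C r := fun r =>
    (substAlgHom (R := CharRing K G) hS).commutes r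
  simp only [map_mul, map_pow, map_add, map_one, map_sum, hX, hC] at h'
  rw [coe_substAlgHom, ← gammaSeries_eq_subst] at h'
  -- As `1 + t/(1-t) = 1/(1-t)`, the factor `(1+t)ᵈ` coming from the constant `d` becomes `(1-t)⁻ᵈ`.
  -- Multiplying by `(1-t)ᵈ` isolates `γ_t(x)`.
  have h1 : (1 + X * PowerSeries.mk 1 : PowerSeries (CharRing K G)) = PowerSeries.mk 1 := by
    linear_combination -hm
  rw [h1] at h'
  have h2 := congrArg (· * (1 - X : PowerSeries (CharRing K G)) ^ d) h'
  simp only [Finset.sum_mul] at h2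
  rw [mul_assoc, ← mul_pow, hm, one_pow, mul_one] at h2
  rw [h2]
  refine Finset.sum_congr rfl fun i hi => ?_
  obtain ⟨j, rfl⟩ : ∃ j, d = i + j := ⟨d - i, by have := Finset.mem_range.1 hi; omega⟩
  rw [Nat.add_sub_cancel_left, pow_add, mul_pow]
  linear_combination (C (a i) * X ^ i * (1 - X) ^ j) *
    (mul_pow (PowerSeries.mk 1 : PowerSeries (CharRing K G)) (1 - X) i).symm.trans
      (by rw [hm, one_pow])

end GammaSeries

/-! ### Bounding the Grothendieck filtration from above -/

section Filtration

variable {K : Type*} [Field K] [CharZero K] {G : Type*} [Group G]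

theorem RingFiltration.step_antitone {A : Type*} [CommRing A] (F : RingFiltration A) :
    Antitone F.step :=
  antitone_nat_of_succ_le F.step_succ_le

theorem RingFiltration.list_prod_mem {A : Type*} [CommRing A] (F : RingFiltration A) {ι : Type*}
    (n : ι → ℕ) (f : ι → A) (l : List ι) (h : ∀ i ∈ l, f i ∈ F.step (n i)) :
    (l.map f).prod ∈ F.step (l.map n).sum := by
  induction l with
  | nil => exact F.one_mem
  | cons i l ih =>
    rw [List.map_cons, List.map_cons, List.prod_cons, List.sum_cons]
    exact F.mul_mem (h i (by simp)) (ih fun j hj => h j (by simp [hj]))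

/-- A ring filtration contains the Grothendieck filtration as soon as it contains the `γⁿ(x)`, for
`x` in a set of generators of the augmentation ideal. -/
theorem gammaFiltration_le (F : RingFiltration (CharRing K G)) (X : Set (CharRing K G))
    (hX : ∀ x : CharRing K G, augmentation x = 0 → x ∈ AddSubgroup.closure X)
    (h : ∀ x ∈ X, ∀ n, gammaOp n x ∈ F.step n) (n : ℕ) :
    (gammaFiltration K G).step n ≤ F.step n := by
  -- The elements `x` with `γⁿ(x)` in step `n` for all `n` form a subgroup, because `γ_t` sends sums
  -- to products.
  have key : ∀ x ∈ AddSubgroup.closure X, ∀ n, gammaOp n x ∈ F.step n := by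
    intro x hx
    induction hx using AddSubgroup.closure_induction with
    | mem x hx => exact h x hx
    | zero =>
      rintro (_ | n)
      · rw [gammaOp_zero]; exact F.one_mem
      · rw [gammaOp_zero_right]; exact zero_mem _
    | add x y _ _ hx hy =>
      intro n
      rw [gammaOp_add]
      refine sum_mem fun p hp => ?_
      rw [← Finset.HasAntidiagonal.mem_antidiagonal.1 hp]
      exact F.mul_mem (hx _) (hy _)
    | neg x _ hx =>
      intro n
      induction n using Nat.strong_induction_on with
      | _ n ih =>
        cases n with
        | zero => rw [gammaOp_zero]; exact F.one_mem
        | succ n =>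
          -- The relation `γ_t(x) γ_t(-x) = 1` expresses `γⁿ⁺¹(-x)` through products `γⁱ(x) γʲ(-x)`
          -- with `i ≥ 1`, `i + j = n + 1`, hence `j ≤ n`.
          have h0 := gammaOp_add (n + 1) x (-x)
          rw [add_neg_cancel, gammaOp_zero_right, Finset.Nat.antidiagonal_succ, Finset.sum_cons,
            gammaOp_zero, one_mul, Finset.sum_map] at h0
          rw [eq_neg_of_add_eq_zero_left h0.symm]
          refine neg_mem (sum_mem fun p hp => ?_)
          have hp' := Finset.HasAntidiagonal.mem_antidiagonal.1 hp
          have : n + 1 = (p.1 + 1) + p.2 := by omega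
          rw [this]
          exact F.mul_mem (hx _) (ih _ (by omega))
  refine (AddSubgroup.closure_le _).2 ?_
  rintro m ⟨l, h1, h2, rfl⟩
  exact F.step_antitone h2 (F.list_prod_mem _ _ l fun p hp => key _ (hX _ (h1 p hp)) _)

theorem gammaOp_one (x : CharRing K G) : gammaOp 1 x = x := by
  rw [gammaOp, lambdaOp, Nat.cast_one, add_sub_cancel_right]
  refine Subtype.ext <| funext fun g => ?_
  have h := congrArg (PowerSeries.coeff 0) (derivative_map_evalAt_lambdaSeries x g)
  rw [PowerSeries.coeff_derivative, PowerSeries.coeff_map] at h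
  rw [PowerSeries.coeff_zero_eq_constantCoeff_apply, map_mul,
    constantCoeff_map_evalAt_lambdaSeries] at h
  simpa [evalAt] using h

theorem gammaOp_mem_gammaFiltration (n : ℕ) {x : CharRing K G} (hx : augmentation x = 0) :
    gammaOp n x ∈ (gammaFiltration K G).step n :=
  AddSubgroup.subset_closure ⟨[(n, x)], by simpa using hx, by simp, by simp⟩

theorem mem_gammaFiltration_one {x : CharRing K G} (hx : augmentation x = 0) :
    x ∈ (gammaFiltration K G).step 1 := by
  simpa only [gammaOp_one] using gammaOp_mem_gammaFiltration 1 hx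

theorem augmentation_eq_zero_iff {x : CharRing K G} :
    augmentation x = 0 ↔ (x : G → K) 1 = 0 := by
  rw [← cast_augmentation, Int.cast_eq_zero]

end Filtration

/-! ### Filtrations defined by divisibility of values -/

section Evaluation

variable {K : Type*} [Field K] {G : Type*} [Group G]

theorem ofNat_apply (n : ℕ) [n.AtLeastTwo] (g : G) :
    ((ofNat(n) : CharRing K G) : G → K) g = ofNat(n) :=
  map_ofNat (evalAt g) n

/-- The virtual characters with values at `g` in `dₙ S`, for a subring `S` of the base field. -/
def evalFiltration (g : G) (S : Subring K) (d : ℕ → K) (h0 : d 0 = 1)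
    (hsucc : ∀ n, ∃ s ∈ S, d (n + 1) = d n * s)
    (hmul : ∀ i j, ∃ s ∈ S, d i * d j = d (i + j) * s) : RingFiltration (CharRing K G) where
  step n :=
    { carrier := {x | ∃ s ∈ S, (x : G → K) g = d n * s}
      zero_mem' := ⟨0, zero_mem _, by simp⟩
      add_mem' := by
        rintro x y ⟨s, hs, hx⟩ ⟨t, ht, hy⟩
        exact ⟨s + t, add_mem hs ht, by
          rw [mul_add, ← hx, ← hy]; rfl⟩
      neg_mem' := by
        rintro x ⟨s, hs, hx⟩
        exact ⟨-s, neg_mem hs, by rw [mul_neg, ← hx]; rfl⟩ }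
  step_succ_le n := by
    rintro x ⟨s, hs, hx⟩
    obtain ⟨t, ht, h⟩ := hsucc n
    exact ⟨t * s, mul_mem ht hs, by rw [hx, h, mul_assoc]⟩
  one_mem := ⟨1, one_mem _, by rw [h0]; simp⟩
  mul_mem := by
    rintro i j x y ⟨s, hs, hx⟩ ⟨t, ht, hy⟩
    obtain ⟨r, hr, h⟩ := hmul i j
    refine ⟨r * (s * t), mul_mem hr (mul_mem hs ht), ?_⟩
    rw [← mul_assoc, ← h]
    change (x : G → K) g * (y : G → K) g = _
    rw [hx, hy]
    ring

theorem mem_evalFiltration_step {g : G} {S : Subring K} {d : ℕ → K} {h0 : d 0 = 1}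
    {hsucc : ∀ n, ∃ s ∈ S, d (n + 1) = d n * s}
    {hmul : ∀ i j, ∃ s ∈ S, d i * d j = d (i + j) * s} {n : ℕ} {x : CharRing K G} :
    x ∈ (evalFiltration g S d h0 hsucc hmul).step n ↔ ∃ s ∈ S, (x : G → K) g = d n * s :=
  Iff.rfl

end Evaluation

/-! ### Integrality of averages and invariance under conjugation -/

section Average

variable {K : Type*} [Field K] {G : Type*} [Group G]

/-- Averaging over the group is a projection onto the invariants, so the mean value of a character
is the dimension of the invariants. Applied to products of characters, this makes multiplicities
integral. -/
theorem exists_int_average_eq [CharZero K] [Fintype G] (x : CharRing K G) :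
    ∃ m : ℤ, ∑ g : G, (x : G → K) g = Fintype.card G * m := by
  have key : ∀ {n : ℕ} (ρ : Representation K G (Fin n → K)),
      ∑ g : G, ρ.character g = Fintype.card G * (Module.finrank K ρ.invariants : ℕ) := by
    intro n ρ
    have : Invertible (Fintype.card G : K) :=
      invertibleOfNonzero (Nat.cast_ne_zero.2 Fintype.card_ne_zero)
    rw [← (Representation.isProj_averageMap ρ).trace]
    simp [Representation.averageMap, Representation.character, GroupAlgebra.average,
      _root_.map_sum]
  obtain ⟨⟨⟨a, ρ⟩, ⟨b, σ⟩⟩, hx⟩ := exists_eq_charOf_sub_charOf x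
  refine ⟨(Module.finrank K ρ.invariants : ℤ) - Module.finrank K σ.invariants, ?_⟩
  rw [hx]
  change ∑ g : G, (ρ.character g - σ.character g) = _
  rw [Finset.sum_sub_distrib, key, key]
  push_cast
  ring

theorem apply_conj_eq (x : CharRing K G) (g h : G) :
    (x : G → K) (h * g * h⁻¹) = (x : G → K) g := by
  obtain ⟨⟨⟨a, ρ⟩, ⟨b, σ⟩⟩, rfl⟩ := exists_eq_charOf_sub_charOf x
  change ρ.character _ - σ.character _ = ρ.character _ - σ.character _
  rw [Representation.char_conj, Representation.char_conj]

end Average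

/-! ### One-dimensional representations -/

section LinearCharacter

variable {K : Type*} [Field K] {G : Type*} [Group G]

/-- The one-dimensional representation defined by a homomorphism `G → Kˣ`. -/
def linearRep (χ : G →* Kˣ) : Representation K G K where
  toFun g := LinearMap.mulLeft K (χ g : K)
  map_one' := by ext; simp
  map_mul' g h := by ext; simp

theorem linearRep_apply_one (χ : G →* Kˣ) (g : G) : linearRep χ g 1 = χ g := by
  simp [linearRep]

theorem charOf_linearRep_apply (χ : G →* Kˣ) (g : G) :
    (charOf (linearRep χ) : G → K) g = χ g := by
  change LinearMap.trace K K (LinearMap.mulLeft K (χ g : K)) = χ g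
  have h : LinearMap.mulLeft K (χ g : K) = (χ g : K) • (1 : K →ₗ[K] K) := by ext; simp
  rw [h, map_smul, LinearMap.trace_one]
  simp

open PowerSeries in
theorem gammaSeries_linearRep_sub_one [CharZero K] (χ : G →* Kˣ) :
    gammaSeries (charOf (linearRep χ) - 1) = 1 + C (charOf (linearRep χ) - 1) * X := by
  rw [gammaSeries_eq_of_lambdaSeries _ 1
    (fun i => if i = 0 then (1 : CharRing K G) else charOf (linearRep χ))]
  · simp [Finset.sum_range_succ]
    ring
  · rw [Nat.cast_one, sub_add_cancel, lambdaSeries_of_isMultiplicative]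
    · simp [Finset.sum_range_succ]
    · simp [charOf_linearRep_apply]

end LinearCharacter

/-! ### Divisibility of values at involutions -/

section Cyclic

variable {G : Type*} [Group G]

/-- The homomorphism from the cyclic group of order `n` sending the generator to `p`. -/
def zmodPowHom {n : ℕ} [NeZero n] (p : G) (hp : p ^ n = 1) : Multiplicative (ZMod n) →* G where
  toFun x := p ^ x.toAdd.val
  map_one' := by simp
  map_mul' x y := by
    rw [toAdd_mul, ZMod.val_add, ← pow_add, ← pow_eq_pow_mod _ hp]

theorem zmodPowHom_apply {n : ℕ} [NeZero n] (p : G) (hp : p ^ n = 1)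
    (x : Multiplicative (ZMod n)) : zmodPowHom p hp x = p ^ x.toAdd.val := rfl

theorem gammaOp_linearRep_sub_one (χ : G →* ℂˣ) (n : ℕ) :
    gammaOp n (charOf (linearRep χ) - 1) =
      if n = 0 then 1 else if n = 1 then charOf (linearRep χ) - 1 else 0 := by
  have h := congrArg (PowerSeries.coeff n) (gammaSeries_linearRep_sub_one χ)
  rw [gammaSeries, PowerSeries.coeff_mk] at h
  rw [h, map_add, PowerSeries.coeff_C_mul, PowerSeries.coeff_one, PowerSeries.coeff_X]
  rcases n with _ | _ | n <;> simp

/-- The augmentation ideal of `R(C₂)` is generated by `ε - 1` with `ε` the sign character. Its only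
nonzero positive `γ`-operation is `γ¹`, and its value at the generator is `-2`. -/
theorem exists_eval_eq_two_pow_mul_cyclic {n : ℕ} {x : CharRing ℂ (Multiplicative (ZMod 2))}
    (hx : x ∈ (gammaFiltration ℂ _).step n) :
    ∃ m : ℤ, (x : Multiplicative (ZMod 2) → ℂ) (Multiplicative.ofAdd 1) = 2 ^ n * m := by
  let ε : Multiplicative (ZMod 2) →* ℂˣ := zmodPowHom (-1) (by norm_num)
  have hε1 :
      (charOf (linearRep ε) : Multiplicative (ZMod 2) → ℂ) (Multiplicative.ofAdd 1) = -1 := by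
    rw [charOf_linearRep_apply, zmodPowHom_apply, toAdd_ofAdd, ZMod.val_one, pow_one]
    simp
  have h := gammaFiltration_le
    (evalFiltration (Multiplicative.ofAdd 1) (Int.castRingHom ℂ).range (fun n => 2 ^ n) (by simp)
      (fun n => ⟨2, ⟨2, by simp⟩, by ring⟩) (fun i j => ⟨1, one_mem _, by ring⟩))
    {charOf (linearRep ε) - 1} ?_ ?_ n hx
  · obtain ⟨_, ⟨m, rfl⟩, h⟩ := mem_evalFiltration_step.1 h
    exact ⟨m, by simpa using h⟩
  · intro y hy
    rw [augmentation_eq_zero_iff] at hy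
    obtain ⟨m, hm⟩ := exists_int_average_eq y
    have hsum : ∑ g, (y : Multiplicative (ZMod 2) → ℂ) g =
        (y : Multiplicative (ZMod 2) → ℂ) 1 +
          (y : Multiplicative (ZMod 2) → ℂ) (Multiplicative.ofAdd 1) := by
      rw [show (Finset.univ : Finset (Multiplicative (ZMod 2))) = {1, Multiplicative.ofAdd 1} by
        decide, Finset.sum_pair (by decide)]
    have hcard : Fintype.card (Multiplicative (ZMod 2)) = 2 := rfl
    rw [hsum, hcard, hy, zero_add] at hm
    -- Here `y` vanishes at `1` and equals `2m` at the generator, where `ε - 1` equals `-2`.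
    have : y = (-m) • (charOf (linearRep ε) - 1) := by
      refine Subtype.ext <| funext fun g => ?_
      have hg : g = 1 ∨ g = Multiplicative.ofAdd 1 := by revert g; decide
      have hval : (((-m) • (charOf (linearRep ε) - 1) : CharRing ℂ (Multiplicative (ZMod 2))) :
          Multiplicative (ZMod 2) → ℂ) g =
            -m * ((charOf (linearRep ε) : Multiplicative (ZMod 2) → ℂ) g - 1) := by
        simp
      rw [hval]
      rcases hg with rfl | rfl
      · rw [hy, charOf_linearRep_apply]; simp
      · rw [hm, hε1]; push_cast; ring
    rw [this]
    exact zsmul_mem (AddSubgroup.subset_closure (Set.mem_singleton _)) _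
  · intro y hy n
    rw [Set.mem_singleton_iff.1 hy, gammaOp_linearRep_sub_one]
    split_ifs with h0 h1
    · subst h0; exact RingFiltration.one_mem _
    · subst h1
      refine mem_evalFiltration_step.2 ⟨-1, ⟨-1, by simp⟩, ?_⟩
      change (charOf (linearRep ε) : Multiplicative (ZMod 2) → ℂ) _ - 1 = _
      rw [hε1]; norm_num
    · exact zero_mem _

/-- Elements of `Γⁿ` take values divisible by `2ⁿ` at involutions. -/
theorem exists_eval_eq_two_pow_mul {p : G} (hp : p ^ 2 = 1) {n : ℕ} {x : CharRing ℂ G}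
    (hx : x ∈ (gammaFiltration ℂ G).step n) : ∃ m : ℤ, (x : G → ℂ) p = 2 ^ n * m := by
  obtain ⟨m, hm⟩ := exists_eval_eq_two_pow_mul_cyclic
    (pullback_mem_step (zmodPowHom p hp) n x hx)
  refine ⟨m, ?_⟩
  rw [← hm]
  change _ = (x : G → ℂ) (p ^ _)
  rw [toAdd_ofAdd, ZMod.val_one, pow_one]

end Cyclic

/-! ### Characters of `A₄` and generators of the augmentation ideal -/

section AlternatingGroup

/-- The index of the partition of `Fin 4` into two pairs which contains the pair `{a, b}`. -/
def pairingIndex (a b : Fin 4) : ZMod 3 :=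
  -- The index is the partner of `3` in the partition. If the pair avoids `3`, that partner is the
  -- third element of `{0, 1, 2}`, and `0 + 1 + 2 = 0` in `ZMod 3`.
  if a = 3 then b.val else if b = 3 then a.val else -(a.val + b.val)

/-- The quotient map from `A₄` to the cyclic group of order three. -/
def a4ToZMod3 : A4 →* Multiplicative (ZMod 3) :=
  MonoidHom.mk' (fun σ => Multiplicative.ofAdd
    (pairingIndex ((σ : Equiv.Perm (Fin 4)) 3) ((σ : Equiv.Perm (Fin 4)) 0))) (by decide +kernel)

theorem a4ToZMod3_cycle123 : a4ToZMod3 cycle123 = Multiplicative.ofAdd 1 := by decide +kernel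

theorem a4ToZMod3_swap12swap34 : a4ToZMod3 swap12swap34 = 1 := by decide +kernel

/-- The primitive cube root of unity `e^{2πi/3}`. -/
def omega : ℂ := Complex.exp (2 * Real.pi * Complex.I / 3)

theorem isPrimitiveRoot_omega : IsPrimitiveRoot omega 3 :=
  Complex.isPrimitiveRoot_exp 3 (by norm_num)

theorem omega_pow_three : omega ^ 3 = 1 := isPrimitiveRoot_omega.pow_eq_one

theorem omega_sq : omega ^ 2 = -1 - omega := by
  have h := isPrimitiveRoot_omega.geom_sum_eq_zero (by norm_num)
  simp only [Finset.sum_range_succ, Finset.sum_range_zero, pow_zero, pow_one] at h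
  linear_combination h

/-- The linear character of `A₄` with value `e^{2πi/3}` at `(1 2 3)`. -/
def a4Char : A4 →* ℂˣ :=
  (zmodPowHom (n := 3) (Units.mk0 omega (isPrimitiveRoot_omega.ne_zero (by norm_num)))
    (Units.ext (by simpa using omega_pow_three))).comp a4ToZMod3

theorem a4Char_cycle123 : (a4Char cycle123 : ℂ) = omega := by
  rw [a4Char, MonoidHom.comp_apply, a4ToZMod3_cycle123, zmodPowHom_apply, toAdd_ofAdd]
  simp [ZMod.val_one]

theorem a4Char_swap12swap34 : a4Char swap12swap34 = 1 := by
  rw [a4Char, MonoidHom.comp_apply, a4ToZMod3_swap12swap34, map_one]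

theorem a4_eq_conj (σ : A4) : σ = 1 ∨ (∃ τ : A4, τ * swap12swap34 * τ⁻¹ = σ) ∨
    (∃ τ : A4, τ * cycle123 * τ⁻¹ = σ) ∨ ∃ τ : A4, τ * cycle123 ^ 2 * τ⁻¹ = σ := by
  revert σ
  decide +kernel

theorem a4_charRing_ext {x y : CharRing ℂ A4} (h1 : (x : A4 → ℂ) 1 = (y : A4 → ℂ) 1)
    (h2 : (x : A4 → ℂ) swap12swap34 = (y : A4 → ℂ) swap12swap34)
    (h3 : (x : A4 → ℂ) cycle123 = (y : A4 → ℂ) cycle123)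
    (h4 : (x : A4 → ℂ) (cycle123 ^ 2) = (y : A4 → ℂ) (cycle123 ^ 2)) : x = y := by
  refine Subtype.ext <| funext fun g => ?_
  rcases a4_eq_conj g with rfl | ⟨τ, rfl⟩ | ⟨τ, rfl⟩ | ⟨τ, rfl⟩
  · exact h1
  all_goals rw [apply_conj_eq, apply_conj_eq]; assumption

/-- An index for the conjugacy class of an element of `A₄`. -/
def a4Class (σ : A4) : Fin 4 :=
  if σ = 1 then 0 else if a4ToZMod3 σ = 1 then 1 else
    if a4ToZMod3 σ = Multiplicative.ofAdd 1 then 2 else 3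

theorem a4_sum_eq (x : CharRing ℂ A4) : ∑ g : A4, (x : A4 → ℂ) g =
    (x : A4 → ℂ) 1 + 3 * (x : A4 → ℂ) swap12swap34 + 4 * (x : A4 → ℂ) cycle123 +
      4 * (x : A4 → ℂ) (cycle123 ^ 2) := by
  let r : Fin 4 → A4 := ![1, swap12swap34, cycle123, cycle123 ^ 2]
  have hr : ∀ σ : A4, ∃ τ : A4,
      τ * ![1, swap12swap34, cycle123, cycle123 ^ 2] (a4Class σ) * τ⁻¹ = σ := by
    decide +kernel
  have hx : ∀ σ, (x : A4 → ℂ) σ = (x : A4 → ℂ) (r (a4Class σ)) := by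
    intro σ
    obtain ⟨τ, hτ⟩ := hr σ
    conv_lhs => rw [← hτ]
    exact apply_conj_eq _ _ _
  have hc : ∀ i : Fin 4, (Finset.univ.filter fun σ : A4 => a4Class σ = i).card =
      ![1, 3, 4, 4] i := by decide +kernel
  rw [Finset.sum_congr rfl fun σ _ => hx σ,
    ← Finset.sum_fiberwise (Finset.univ : Finset A4) a4Class]
  have hs : ∀ i : Fin 4, ∑ σ ∈ Finset.univ.filter (fun σ : A4 => a4Class σ = i),
      (x : A4 → ℂ) (r (a4Class σ)) = (![1, 3, 4, 4] i : ℕ) * (x : A4 → ℂ) (r i) := by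
    intro i
    rw [← hc i, ← nsmul_eq_mul]
    refine Finset.sum_eq_card_nsmul fun σ hσ => ?_
    rw [(Finset.mem_filter.1 hσ).2]
  simp_rw [hs]
  rw [Fin.sum_univ_four]
  change ((1 : ℕ) : ℂ) * (x : A4 → ℂ) 1 + ((3 : ℕ) : ℂ) * (x : A4 → ℂ) swap12swap34 +
    ((4 : ℕ) : ℂ) * (x : A4 → ℂ) cycle123 + ((4 : ℕ) : ℂ) * (x : A4 → ℂ) (cycle123 ^ 2) = _
  norm_num

/-- The class of the character `ρ` of `A₄` in the representation ring. -/
def rhoChar : CharRing ℂ A4 := charOf (linearRep a4Char)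

theorem rhoChar_one : (rhoChar : A4 → ℂ) 1 = 1 := by
  simp [rhoChar, charOf_linearRep_apply]

theorem rhoChar_swap12swap34 : (rhoChar : A4 → ℂ) swap12swap34 = 1 := by
  simp [rhoChar, charOf_linearRep_apply, a4Char_swap12swap34]

theorem rhoChar_cycle123 : (rhoChar : A4 → ℂ) cycle123 = omega := by
  rw [rhoChar, charOf_linearRep_apply, a4Char_cycle123]

theorem rhoChar_cycle123_sq : (rhoChar : A4 → ℂ) (cycle123 ^ 2) = -1 - omega := by
  rw [rhoChar, charOf_linearRep_apply, map_pow, Units.val_pow_eq_pow_val, a4Char_cycle123, omega_sq]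

theorem rhoChar_sq : rhoChar ^ 2 = charOf (linearRep (a4Char ^ 2)) := by
  refine Subtype.ext <| funext fun g => ?_
  rw [charOf_linearRep_apply]
  change (rhoChar : A4 → ℂ) g ^ 2 = _
  rw [rhoChar, charOf_linearRep_apply]
  simp

theorem character_ofMulAction {G X : Type*} [Group G] [MulAction G X] [Fintype X] [DecidableEq X]
    (g : G) : (Representation.ofMulAction ℂ G X).character g =
      (Finset.univ.filter fun i : X => g • i = i).card := by
  rw [Representation.character, LinearMap.trace_eq_matrix_trace ℂ (MonoidAlgebra.basis X ℂ),
    Matrix.trace]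
  simp [LinearMap.toMatrix_apply, MonoidAlgebra.basis, Finsupp.single_apply]

theorem standardChar_apply (σ : A4) : (standardChar : A4 → ℂ) σ =
    (((Finset.univ.filter fun i : Fin 4 => σ • i = i).card : ℤ) - 1 : ℤ) := by
  change (Representation.ofMulAction ℂ A4 (Fin 4)).character σ - 1 = _
  rw [character_ofMulAction]
  simp

theorem standardChar_one : (standardChar : A4 → ℂ) 1 = 3 := by
  rw [standardChar_apply, show ((Finset.univ.filter fun i : Fin 4 => (1 : A4) • i = i).card : ℤ) - 1
    = 3 by decide +kernel]
  norm_num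

theorem standardChar_swap12swap34 : (standardChar : A4 → ℂ) swap12swap34 = -1 := by
  rw [standardChar_apply, show ((Finset.univ.filter fun i : Fin 4 => swap12swap34 • i = i).card : ℤ)
    - 1 = -1 by decide +kernel]
  norm_num

theorem standardChar_cycle123 : (standardChar : A4 → ℂ) cycle123 = 0 := by
  rw [standardChar_apply, show ((Finset.univ.filter fun i : Fin 4 => cycle123 • i = i).card : ℤ)
    - 1 = 0 by decide +kernel]
  norm_num

theorem standardChar_cycle123_sq : (standardChar : A4 → ℂ) (cycle123 ^ 2) = 0 := by
  rw [standardChar_apply,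
    show ((Finset.univ.filter fun i : Fin 4 => (cycle123 ^ 2) • i = i).card : ℤ) - 1 = 0 by decide +kernel]
  norm_num

/-- The coefficients are the multiplicities of `ρ`, `ρ²` and `θ` in `x`, integral by
`exists_int_average_eq`. The vanishing degree takes care of the trivial character. Equality is
checked on conjugacy classes, so completeness of the list of irreducible characters is never
invoked. -/
theorem mem_closure_of_augmentation_eq_zero {x : CharRing ℂ A4} (hx : augmentation x = 0) :
    x ∈ AddSubgroup.closure
      ({charOf (linearRep a4Char) - 1, charOf (linearRep (a4Char ^ 2)) - 1, standardChar - 3} :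
        Set (CharRing ℂ A4)) := by
  rw [augmentation_eq_zero_iff] at hx
  -- The conjugate of `ρ` is `ρ²`, so the mean of `xρ²` is the multiplicity of `ρ`, and that of `xρ`
  -- is the multiplicity of `ρ²`. The character `θ` is real.
  obtain ⟨m₁, h₁⟩ := exists_int_average_eq (x * rhoChar ^ 2)
  obtain ⟨m₂, h₂⟩ := exists_int_average_eq (x * rhoChar)
  obtain ⟨m₃, h₃⟩ := exists_int_average_eq (x * standardChar)
  have hcard : Fintype.card A4 = 12 := by decide +kernel
  rw [a4_sum_eq, hcard] at h₁ h₂ h₃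
  simp only [Subring.coe_mul, Subring.coe_pow, Pi.mul_apply, Pi.pow_apply, hx, rhoChar_one,
    rhoChar_swap12swap34, rhoChar_cycle123, rhoChar_cycle123_sq, standardChar_one,
    standardChar_swap12swap34, standardChar_cycle123, standardChar_cycle123_sq] at h₁ h₂ h₃
  rw [← rhoChar_sq]
  change x ∈ AddSubgroup.closure {rhoChar - 1, _, _}
  have hw := omega_sq
  have key : x = m₁ • (rhoChar - 1) + m₂ • (rhoChar ^ 2 - 1) + m₃ • (standardChar - 3) := by
    have hval : ∀ g, ((m₁ • (rhoChar - 1) + m₂ • (rhoChar ^ 2 - 1) + m₃ • (standardChar - 3) :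
        CharRing ℂ A4) : A4 → ℂ) g = m₁ * ((rhoChar : A4 → ℂ) g - 1) +
          m₂ * ((rhoChar : A4 → ℂ) g ^ 2 - 1) + m₃ * ((standardChar : A4 → ℂ) g - 3) := by
      intro g
      simp [ofNat_apply]
    push_cast at h₁ h₂ h₃
    have hw' : (-1 - omega) ^ 2 = omega := by linear_combination hw
    rw [hw, hw'] at h₁
    refine a4_charRing_ext ?_ ?_ ?_ ?_ <;> rw [hval]
    · rw [hx, rhoChar_one, standardChar_one]; ring
    · rw [rhoChar_swap12swap34, standardChar_swap12swap34]
      linear_combination (-1 / 3 : ℂ) * h₃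
    · rw [rhoChar_cycle123, standardChar_cycle123, hw]
      linear_combination ((omega - 1) / 12) * h₁ + ((-2 - omega) / 12) * h₂ - (1 / 4 : ℂ) * h₃ +
        (2 / 3 : ℂ) * ((x : A4 → ℂ) cycle123 - (x : A4 → ℂ) (cycle123 ^ 2)) * hw
    · rw [rhoChar_cycle123_sq, standardChar_cycle123_sq, hw']
      linear_combination ((-2 - omega) / 12) * h₁ + ((omega - 1) / 12) * h₂ - (1 / 4 : ℂ) * h₃ +
        (2 / 3 : ℂ) * ((x : A4 → ℂ) (cycle123 ^ 2) - (x : A4 → ℂ) cycle123) * hw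
  rw [key]
  refine add_mem (add_mem ?_ ?_) ?_ <;>
    exact zsmul_mem (AddSubgroup.subset_closure (by simp)) _

end AlternatingGroup

/-! ### `γ`-operations on `θ - 3` and divisibility bounds for `A₄` -/

section AlternatingGroupGamma

theorem a4_order_cases (σ : A4) : σ = 1 ∨
    (σ ^ 2 = 1 ∧ ((Finset.univ.filter fun i : Fin 4 => σ • i = i).card : ℤ) - 1 = -1) ∨
    (σ ^ 3 = 1 ∧ ((Finset.univ.filter fun i : Fin 4 => σ • i = i).card : ℤ) - 1 = 0 ∧
      ((Finset.univ.filter fun i : Fin 4 => (σ ^ 2) • i = i).card : ℤ) - 1 = 0) := by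
  revert σ
  decide +kernel

open PowerSeries in
-- The eigenvalues of `θ` are `1, 1, 1` at the identity, `1, -1, -1` at involutions and `1, ω, ω²`
-- at elements of order three. In each case the determinant is `1` and the second symmetric function
-- equals the trace.
theorem lambdaSeries_standardChar :
    lambdaSeries standardChar = 1 + C standardChar * X + C standardChar * X ^ 2 + X ^ 3 := by
  refine powerSeries_ext fun σ => ?_
  have hmap : PowerSeries.map (evalAt σ)
      (1 + C standardChar * X + C standardChar * X ^ 2 + X ^ 3 : PowerSeries (CharRing ℂ A4)) =
      1 + C ((standardChar : A4 → ℂ) σ) * X + C ((standardChar : A4 → ℂ) σ) * X ^ 2 + X ^ 3 := by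
    simp [evalAt]
  rw [hmap]
  rcases a4_order_cases σ with rfl | ⟨h2, hσ⟩ | ⟨h3, hσ, hσ2⟩
  · rw [map_evalAt_lambdaSeries_eq_prod _ _ [1, 1, 1], standardChar_one]
    · have h3 : (C (3 : ℂ) : PowerSeries ℂ) = 3 := map_ofNat _ 3
      simp [h3]
      ring
    · intro k
      rw [one_pow, standardChar_one]
      norm_num
  · have hs : (standardChar : A4 → ℂ) σ = -1 := by rw [standardChar_apply, hσ]; norm_num
    rw [map_evalAt_lambdaSeries_eq_prod _ _ [1, -1, -1], hs]
    · simp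
      ring
    · intro k
      -- For an involution both sides depend only on the parity of the exponent.
      rcases Nat.even_or_odd' (k + 1) with ⟨m, hm | hm⟩
      · rw [hm, pow_mul, h2, one_pow, standardChar_one]
        simp [pow_mul]
        norm_num
      · rw [hm, pow_succ, pow_mul, h2, one_pow, one_mul, hs]
        simp [pow_succ, pow_mul]
  · have hs : (standardChar : A4 → ℂ) σ = 0 := by rw [standardChar_apply, hσ]; norm_num
    have hs2 : (standardChar : A4 → ℂ) (σ ^ 2) = 0 := by rw [standardChar_apply, hσ2]; norm_num
    have hC : (C omega : PowerSeries ℂ) ^ 2 = -1 - C omega := by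
      rw [← map_pow, omega_sq, map_sub, map_neg, map_one]
    have hw := omega_sq
    rw [map_evalAt_lambdaSeries_eq_prod _ _ [1, omega, -1 - omega], hs]
    · simp
      linear_combination (-X ^ 2 - X ^ 3) * hC
    · intro k
      have hw3 : (-1 - omega) ^ 3 = 1 := by linear_combination (-2 - omega) * hw
      have hw2 : (-1 - omega) ^ 2 = omega := by linear_combination hw
      -- All the cubes involved are `1`, so only the exponent modulo three matters.
      rw [pow_eq_pow_mod (k + 1) h3]
      simp only [List.map_cons, List.map_nil, List.sum_cons, List.sum_nil]
      rw [pow_eq_pow_mod (k + 1) omega_pow_three, pow_eq_pow_mod (k + 1) hw3, one_pow]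
      have hlt := Nat.mod_lt (k + 1) (show 3 > 0 by norm_num)
      interval_cases (k + 1) % 3
      · rw [pow_zero, pow_zero, pow_zero, standardChar_one]; norm_num
      · rw [pow_one, pow_one, pow_one, hs]; ring
      · rw [hs2, hw2, hw]; ring

open PowerSeries in
-- The sum `(1-t)³ + θt(1-t)² + θt²(1-t) + t³` collapses to `(1-t)³ + θt(1-t) + t³`, whose cubic
-- terms cancel. So `γ³` vanishes, and `γ² = 3 - θ = -γ¹`.
theorem gammaSeries_standardChar_sub_three : gammaSeries (standardChar - 3) =
    1 + C (standardChar - 3) * X + C (3 - standardChar) * X ^ 2 := by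
  rw [gammaSeries_eq_of_lambdaSeries _ 3
    (fun i => if i = 0 ∨ i = 3 then (1 : CharRing ℂ A4) else standardChar)]
  · simp only [Finset.sum_range_succ, Finset.sum_range_zero]
    have h3 : (C (3 : CharRing ℂ A4) : PowerSeries (CharRing ℂ A4)) = 3 := map_ofNat _ 3
    simp [h3]
    ring
  · rw [Nat.cast_ofNat, sub_add_cancel, lambdaSeries_standardChar]
    simp [Finset.sum_range_succ]

theorem gammaOp_standardChar_sub_three (n : ℕ) : gammaOp n (standardChar - 3) =
    if n = 0 then 1 else if n = 1 then standardChar - 3 else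
      if n = 2 then 3 - standardChar else 0 := by
  have h := congrArg (PowerSeries.coeff n) gammaSeries_standardChar_sub_three
  rw [gammaSeries, PowerSeries.coeff_mk] at h
  rw [h, map_add, map_add, PowerSeries.coeff_C_mul, PowerSeries.coeff_C_mul,
    PowerSeries.coeff_one, PowerSeries.coeff_X, PowerSeries.coeff_X_pow]
  rcases n with _ | _ | _ | n <;> simp

/-- To bound the Grothendieck filtration of `A₄` it suffices to consider the generators
`ρ - 1`, `ρ² - 1`, `θ - 3` and `3 - θ`, of weights `1`, `1`, `1` and `2`. -/
theorem a4_gammaFiltration_le (F : RingFiltration (CharRing ℂ A4))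
    (h₁ : rhoChar - 1 ∈ F.step 1) (h₂ : rhoChar ^ 2 - 1 ∈ F.step 1)
    (h₃ : 3 - standardChar ∈ F.step 2) (n : ℕ) : (gammaFiltration ℂ A4).step n ≤ F.step n := by
  refine gammaFiltration_le F _ (fun x => mem_closure_of_augmentation_eq_zero) ?_ n
  rintro x (rfl | rfl | rfl) n
  · rw [gammaOp_linearRep_sub_one]
    split_ifs with h0 h1
    · subst h0; exact F.one_mem
    · subst h1; exact h₁
    · exact zero_mem _
  · rw [gammaOp_linearRep_sub_one]
    split_ifs with h0 h1
    · subst h0; exact F.one_mem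
    · subst h1; rw [← rhoChar_sq]; exact h₂
    · exact zero_mem _
  · rw [gammaOp_standardChar_sub_three]
    split_ifs with h0 h1 h2
    · subst h0; exact F.one_mem
    · subst h1; rw [← neg_sub]; exact neg_mem (F.step_succ_le 1 h₃)
    · subst h2; exact h₃
    · exact zero_mem _

/-- The weight one generators `ρ - 1` and `ρ² - 1` vanish here, while `3 - θ`, of weight two, takes
the value `4`. The exponent `(n + 1) / 2` is `⌈n/2⌉`, which is subadditive. For odd `n` this beats
the bound `2ⁿ` valid for every group, and that gain drives the obstruction in degree three. -/
theorem exists_eval_swap12swap34_eq {n : ℕ} {x : CharRing ℂ A4}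
    (hx : x ∈ (gammaFiltration ℂ A4).step n) :
    ∃ m : ℤ, (x : A4 → ℂ) swap12swap34 = 4 ^ ((n + 1) / 2) * m := by
  have h4 : (4 : ℂ) ∈ (Int.castRingHom ℂ).range := ⟨4, by simp⟩
  have h := a4_gammaFiltration_le
    (evalFiltration swap12swap34 (Int.castRingHom ℂ).range (fun n => 4 ^ ((n + 1) / 2)) (by simp)
      ?_ ?_) ?_ ?_ ?_ n hx
  · obtain ⟨_, ⟨m, rfl⟩, h⟩ := mem_evalFiltration_step.1 h
    exact ⟨m, by simpa using h⟩
  · intro n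
    refine ⟨4 ^ ((n + 1 + 1) / 2 - (n + 1) / 2), pow_mem h4 _, ?_⟩
    rw [← pow_add]
    congr 1
    omega
  · intro i j
    refine ⟨4 ^ ((i + 1) / 2 + (j + 1) / 2 - (i + j + 1) / 2), pow_mem h4 _, ?_⟩
    rw [← pow_add, ← pow_add]
    congr 1
    omega
  · refine mem_evalFiltration_step.2 ⟨0, zero_mem _, ?_⟩
    change (rhoChar : A4 → ℂ) _ - 1 = _
    rw [rhoChar_swap12swap34]; ring
  · refine mem_evalFiltration_step.2 ⟨0, zero_mem _, ?_⟩
    change (rhoChar : A4 → ℂ) _ ^ 2 - 1 = _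
    rw [rhoChar_swap12swap34]; ring
  · refine mem_evalFiltration_step.2 ⟨1, one_mem _, ?_⟩
    change ((3 : CharRing ℂ A4) : A4 → ℂ) _ - (standardChar : A4 → ℂ) _ = _
    rw [ofNat_apply, standardChar_swap12swap34]; norm_num

/-- The ring of Eisenstein integers, as a subring of `ℂ`. -/
def eisenstein : Subring ℂ where
  carrier := {z | ∃ a b : ℤ, z = a + b * omega}
  zero_mem' := ⟨0, 0, by simp⟩
  one_mem' := ⟨1, 0, by simp⟩
  add_mem' := by
    rintro _ _ ⟨a, b, rfl⟩ ⟨c, d, rfl⟩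
    exact ⟨a + c, b + d, by push_cast; ring⟩
  neg_mem' := by
    rintro _ ⟨a, b, rfl⟩
    exact ⟨-a, -b, by push_cast; ring⟩
  mul_mem' := by
    rintro _ _ ⟨a, b, rfl⟩ ⟨c, d, rfl⟩
    exact ⟨a * c - b * d, a * d + b * c - b * d, by
      push_cast; linear_combination (b * d : ℂ) * omega_sq⟩

/-- The prime above three is `ω - 1`. It divides the values of `ρ - 1` and `ρ² - 1`, and `3 - θ`
takes the value `3 = (ω - 1)²(1 + ω)`, which matches its weight two. -/
theorem exists_eval_cycle123_eq {n : ℕ} {x : CharRing ℂ A4}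
    (hx : x ∈ (gammaFiltration ℂ A4).step n) :
    ∃ a b : ℤ, (x : A4 → ℂ) cycle123 = (omega - 1) ^ n * (a + b * omega) := by
  have hπ : omega - 1 ∈ eisenstein := ⟨-1, 1, by push_cast; ring⟩
  have h := a4_gammaFiltration_le
    (evalFiltration cycle123 eisenstein (fun n => (omega - 1) ^ n) (by simp)
      (fun n => ⟨_, hπ, by ring⟩) (fun i j => ⟨1, one_mem _, by ring⟩)) ?_ ?_ ?_ n hx
  · obtain ⟨_, ⟨a, b, rfl⟩, h⟩ := mem_evalFiltration_step.1 h
    exact ⟨a, b, h⟩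
  · refine mem_evalFiltration_step.2 ⟨1, one_mem _, ?_⟩
    change (rhoChar : A4 → ℂ) _ - 1 = _
    rw [rhoChar_cycle123]; ring
  · refine mem_evalFiltration_step.2 ⟨omega + 1, ⟨1, 1, by push_cast; ring⟩, ?_⟩
    change (rhoChar : A4 → ℂ) _ ^ 2 - 1 = _
    rw [rhoChar_cycle123]; ring
  · refine mem_evalFiltration_step.2 ⟨1 + omega, ⟨1, 1, by push_cast; ring⟩, ?_⟩
    change ((3 : CharRing ℂ A4) : A4 → ℂ) _ - (standardChar : A4 → ℂ) _ = _
    rw [ofNat_apply, standardChar_cycle123]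
    linear_combination (2 - omega) * omega_sq

end AlternatingGroupGamma

/-! ### Symbols in the associated graded ring -/

section Homogeneous

variable {A : Type*} [CommRing A] (F : RingFiltration A)

/-- The class in degree `n` of an element of the `n`-th step of a filtration. -/
def RingFiltration.symbol (n : ℕ) (a : A) (ha : a ∈ F.step n) : F.Graded :=
  DirectSum.of F.Piece n (F.cls a ha)

theorem RingFiltration.symbol_congr {i j : ℕ} {a b : A} (ha : a ∈ F.step i)
    (hb : b ∈ F.step j) (hij : i = j) (hab : a = b) : F.symbol i a ha = F.symbol j b hb := by
  subst hij hab
  rfl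

theorem RingFiltration.symbol_mul {i j : ℕ} {a b : A} (ha : a ∈ F.step i) (hb : b ∈ F.step j) :
    F.symbol i a ha * F.symbol j b hb = F.symbol (i + j) (a * b) (F.mul_mem ha hb) :=
  DirectSum.of_mul_of _ _

theorem RingFiltration.sq_mul_mem {a b : A} (ha : a ∈ F.step 1) (hb : b ∈ F.step 1) :
    a * a * b ∈ F.step 3 := by
  have h : a * a ∈ F.step (1 + 1) := F.mul_mem ha ha
  exact F.mul_mem h hb

theorem RingFiltration.symbol_one : F.symbol 0 1 F.one_mem = 1 := rfl

theorem RingFiltration.symbol_add {n : ℕ} {a b : A} (ha : a ∈ F.step n) (hb : b ∈ F.step n) :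
    F.symbol n (a + b) (add_mem ha hb) = F.symbol n a ha + F.symbol n b hb :=
  map_add (DirectSum.of F.Piece n) (F.cls a ha) (F.cls b hb)

theorem RingFiltration.symbol_neg {n : ℕ} {a : A} (ha : a ∈ F.step n) :
    F.symbol n (-a) (neg_mem ha) = -F.symbol n a ha :=
  map_neg (DirectSum.of F.Piece n) (F.cls a ha)

theorem RingFiltration.symbol_zsmul {n : ℕ} {a : A} (ha : a ∈ F.step n) (m : ℤ) :
    F.symbol n (m • a) (zsmul_mem ha m) = m • F.symbol n a ha :=
  map_zsmul (DirectSum.of F.Piece n) m (F.cls a ha)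

theorem RingFiltration.symbol_pow {i : ℕ} {a : A} (ha : a ∈ F.step i) (k : ℕ) :
    ∃ h, F.symbol i a ha ^ k = F.symbol (i * k) (a ^ k) h := by
  induction k with
  | zero => exact ⟨by simpa using F.one_mem, by
      rw [pow_zero, ← F.symbol_one]
      exact F.symbol_congr _ _ (by simp) (by simp)⟩
  | succ k ih =>
    obtain ⟨h, ih⟩ := ih
    have h' := F.mul_mem h ha
    refine ⟨by rwa [pow_succ, mul_add_one], ?_⟩
    rw [pow_succ, ih, F.symbol_mul]
    exact F.symbol_congr _ _ (by ring) (by ring)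

theorem RingFiltration.cls_eq_zero_iff {n : ℕ} {a : A} (ha : a ∈ F.step n) :
    F.cls a ha = 0 ↔ a ∈ F.step (n + 1) := by
  rw [show (0 : F.Piece n) = F.cls 0 (zero_mem _) from rfl, F.cls_eq_iff]
  simp

theorem RingFiltration.symbol_eq_zero_iff {n : ℕ} {a : A} (ha : a ∈ F.step n) :
    F.symbol n a ha = 0 ↔ a ∈ F.step (n + 1) := by
  rw [← F.cls_eq_zero_iff ha, RingFiltration.symbol,
    map_eq_zero_iff _ (DirectSum.of_injective (β := F.Piece) n)]

theorem RingFiltration.symbol_apply_self {n : ℕ} {a : A} (ha : a ∈ F.step n) :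
    F.symbol n a ha n = F.cls a ha :=
  DirectSum.of_eq_same _ _

theorem RingFiltration.symbol_apply_of_ne {n m : ℕ} (h : m ≠ n) {a : A} (ha : a ∈ F.step n) :
    F.symbol n a ha m = 0 :=
  DirectSum.of_eq_of_ne _ _ _ h

end Homogeneous

/-! ### Pullbacks computed on representatives -/

section Pullback

variable {K : Type*} [Field K] [CharZero K] {G H L : Type*} [Group G] [Group H] [Group L]

theorem gradedPullback_apply_cls (φ : H →* G) (z : GradedCharRing K G) {n : ℕ} {a : CharRing K G}
    (ha : a ∈ (gammaFiltration K G).step n) (h : z n = (gammaFiltration K G).cls a ha) :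
    gradedPullback K φ z n =
      (gammaFiltration K H).cls (pullback φ a) (pullback_mem_step φ n a ha) := by
  rw [gradedPullback, RingFiltration.gradedMap, DirectSum.map_apply, h]
  rfl

theorem gradedPullback_symbol (φ : H →* G) {n : ℕ} {a : CharRing K G}
    (ha : a ∈ (gammaFiltration K G).step n) :
    gradedPullback K φ ((gammaFiltration K G).symbol n a ha) =
      (gammaFiltration K H).symbol n (pullback φ a) (pullback_mem_step φ n a ha) :=
  DirectSum.map_of _ _ _

theorem gradedPullback_comp (φ : H →* G) (ψ : L →* H) (z : GradedCharRing K G) :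
    gradedPullback K ψ (gradedPullback K φ z) = gradedPullback K (φ.comp ψ) z := by
  refine DFinsupp.ext fun n => ?_
  obtain ⟨a, ha, h⟩ := RingFiltration.exists_cls _ (z n)
  rw [gradedPullback_apply_cls _ _ _ (gradedPullback_apply_cls φ z ha h.symm),
    gradedPullback_apply_cls _ z ha h.symm]
  rfl

end Pullback

/-! ### The invariant class on the Klein four-group that is not a restriction -/

section KleinFour

/-- With `a = χ₁ - 1` and `b = χ₂ - 1`, the pair `(a, b)` takes the values `(-2, 0)`, `(0, -2)`,
`(-2, -2)` at the involutions. The term `-a²b` corrects `a³ + b³` from `-16` to `-8` at the third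
one and vanishes at the other two. -/
theorem exists_mem_gammaFiltration_three (P : Type*) [Group P] [IsKleinFour P] :
    ∃ w ∈ (gammaFiltration ℂ P).step 3, ∀ x ≠ 1, (w : P → ℂ) x = -8 := by
  obtain ⟨e⟩ := IsKleinFour.nonempty_mulEquiv (G₁ := P) (G₂ := Multiplicative (ZMod 2 × ZMod 2))
  let s : Multiplicative (ZMod 2) →* ℂˣ := zmodPowHom (-1) (by norm_num)
  let χ₁ : P →* ℂˣ := (s.comp (AddMonoidHom.fst (ZMod 2) (ZMod 2)).toMultiplicative).comp e
  let χ₂ : P →* ℂˣ := (s.comp (AddMonoidHom.snd (ZMod 2) (ZMod 2)).toMultiplicative).comp e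
  have h₁ : ∀ x, (χ₁ x : ℂ) = (-1) ^ (e x).toAdd.1.val := fun x => by
    change (((-1 : ℂˣ) ^ (e x).toAdd.1.val : ℂˣ) : ℂ) = _
    simp
  have h₂ : ∀ x, (χ₂ x : ℂ) = (-1) ^ (e x).toAdd.2.val := fun x => by
    change (((-1 : ℂˣ) ^ (e x).toAdd.2.val : ℂˣ) : ℂ) = _
    simp
  have hmem : ∀ χ : P →* ℂˣ, charOf (linearRep χ) - 1 ∈ (gammaFiltration ℂ P).step 1 := fun χ =>
    mem_gammaFiltration_one (augmentation_eq_zero_iff.2 (by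
      change (charOf (linearRep χ) : P → ℂ) 1 - 1 = 0
      rw [charOf_linearRep_apply]; simp))
  have ha := hmem χ₁
  have hb := hmem χ₂
  set a := charOf (linearRep χ₁) - 1
  set b := charOf (linearRep χ₂) - 1
  have hval : ∀ x, ((a * a * a + b * b * b - a * a * b : CharRing ℂ P) : P → ℂ) x =
      ((-1) ^ (e x).toAdd.1.val - 1) * ((-1) ^ (e x).toAdd.1.val - 1) *
        ((-1) ^ (e x).toAdd.1.val - 1) + ((-1) ^ (e x).toAdd.2.val - 1) *
        ((-1) ^ (e x).toAdd.2.val - 1) * ((-1) ^ (e x).toAdd.2.val - 1) -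
        ((-1) ^ (e x).toAdd.1.val - 1) * ((-1) ^ (e x).toAdd.1.val - 1) *
        ((-1) ^ (e x).toAdd.2.val - 1) := by
    intro x
    rw [← h₁, ← h₂, ← charOf_linearRep_apply, ← charOf_linearRep_apply]
    rfl
  refine ⟨a * a * a + b * b * b - a * a * b, ?_, ?_⟩
  · have h3 : ∀ x ∈ (gammaFiltration ℂ P).step 1, ∀ y ∈ (gammaFiltration ℂ P).step 1,
        x * x * y ∈ (gammaFiltration ℂ P).step 3 := fun x hx y hy =>
      (gammaFiltration ℂ P).sq_mul_mem hx hy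
    exact sub_mem (add_mem (h3 a ha a ha) (h3 b hb b hb)) (h3 a ha b hb)
  · intro x hx
    rw [hval]
    have hy : (e x).toAdd ≠ 0 := fun h => hx (by
      rw [← map_eq_one_iff e e.injective]; exact Multiplicative.toAdd.injective h)
    have hcases : ∀ y : ZMod 2 × ZMod 2, y ≠ 0 → (y.1.val = 0 ∧ y.2.val = 1) ∨
        (y.1.val = 1 ∧ y.2.val = 0) ∨ (y.1.val = 1 ∧ y.2.val = 1) := by decide
    rcases hcases _ hy with ⟨h, h'⟩ | ⟨h, h'⟩ | ⟨h, h'⟩ <;> rw [h, h'] <;> norm_num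

/-- If `f ∈ Γ³` of `A₄` represented the degree three part of a preimage, `m • w - f` would lie in
`Γ⁴` and so be divisible by `16` at `p`. But `f(p)` is divisible by `4² = 16`, whereas `-8m` is not
when `m` is odd. -/
theorem kleinFour_image_obstruction {P : Subgroup A4} {p : A4} (hp : p ∈ P) (hp2 : p ^ 2 = 1)
    (hp1 : p ≠ 1) {w : CharRing ℂ P} (hw : w ∈ (gammaFiltration ℂ P).step 3)
    (hwp : (w : P → ℂ) ⟨p, hp⟩ = -8) {m : ℤ} (hm : Odd m) (z : GradedCharRing ℂ A4) :
    gradedPullback ℂ P.subtype z ≠ m • (gammaFiltration ℂ P).symbol 3 w hw := by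
  intro h
  obtain ⟨f, hf, hz⟩ := RingFiltration.exists_cls _ (z 3)
  have h3 := DFunLike.congr_fun h 3
  rw [gradedPullback_apply_cls _ z hf hz.symm, ← RingFiltration.symbol_zsmul,
    RingFiltration.symbol_apply_self, RingFiltration.cls_eq_iff] at h3
  obtain ⟨k, hk⟩ := exists_eval_eq_two_pow_mul (p := (⟨p, hp⟩ : P)) (Subtype.ext hp2) h3
  obtain ⟨n, hn⟩ := exists_eval_swap12swap34_eq hf
  have hconj : ∀ σ : A4, σ ^ 2 = 1 → σ ≠ 1 → ∃ τ : A4, τ * swap12swap34 * τ⁻¹ = σ := by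
    decide +kernel
  obtain ⟨τ, hτ⟩ := hconj p hp2 hp1
  have hfp : (f : A4 → ℂ) p = 16 * n := by
    rw [← hτ, apply_conj_eq, hn]; norm_num
  have hv : ((m • w - pullback P.subtype f : CharRing ℂ P) : P → ℂ) ⟨p, hp⟩ =
      m * (w : P → ℂ) ⟨p, hp⟩ - (f : A4 → ℂ) p := by
    simp
    rfl
  rw [hv, hwp, hfp] at hk
  have hk' : m * -8 - 16 * n = 2 ^ (3 + 1) * k := by exact_mod_cast hk
  obtain ⟨r, rfl⟩ := hm
  omega

/-- Conjugation permutes the nontrivial elements, on which `w` is constant. So `w` itself is fixed,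
not only its class. -/
theorem gradedConj_symbol_eq {P : Subgroup A4} {w : CharRing ℂ P}
    (hw : w ∈ (gammaFiltration ℂ P).step 3) (hw8 : ∀ x ≠ 1, (w : P → ℂ) x = -8)
    (g : A4) (e : P = conjSubgroup g P) :
    gradedConj ℂ g e ((gammaFiltration ℂ P).symbol 3 w hw) =
      (gammaFiltration ℂ P).symbol 3 w hw := by
  rw [gradedConj, gradedPullback_symbol]
  refine RingFiltration.symbol_congr _ _ _ rfl (Subtype.ext <| funext fun x => ?_)
  change (w : P → ℂ) (conjHom g e x) = (w : P → ℂ) x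
  by_cases hx : x = 1
  · rw [hx, map_one]
  · rw [hw8 x hx, hw8]
    intro h
    apply hx
    have h' := congrArg (fun y : P => (y : A4)) h
    change (MulAut.conj g⁻¹) (x : A4) = 1 at h'
    exact Subtype.ext ((map_eq_one_iff _ (MulAut.conj g⁻¹).injective).1 h')

theorem exists_involution_of_isKleinFour {P : Type*} [Group P] [IsKleinFour P] :
    ∃ p : P, p ≠ 1 ∧ p ^ 2 = 1 := by
  have : Nontrivial P := by
    have h := IsKleinFour.card_four (G := P)
    have : Finite P := Nat.finite_of_card_ne_zero (by rw [h]; norm_num)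
    rw [← Finite.one_lt_card_iff_nontrivial, h]
    norm_num
  obtain ⟨p, hp⟩ := exists_ne (1 : P)
  exact ⟨p, hp, by rw [pow_two, IsKleinFour.mul_self]⟩

theorem isKleinFour_sylow (P : Sylow 2 A4) : IsKleinFour (P : Subgroup A4) := by
  have h4 : Nat.card (Fin 4) = 4 := by simp
  rw [alternatingGroup.two_sylow_eq_kleinFour_of_card_eq_four h4 P]
  exact alternatingGroup.kleinFour_isKleinFour h4

theorem range_gradedPullback_ssubset (P : Sylow 2 A4) :
    Set.range (gradedPullback ℂ (P : Subgroup A4).subtype) ⊂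
      {z : GradedCharRing ℂ (P : Subgroup A4) |
        ∀ (g : A4) (hg : g ∈ Subgroup.normalizer ((P : Subgroup A4) : Set A4)),
          gradedConj ℂ g (conjSubgroup_of_mem_normalizer hg) z = z} := by
  have := isKleinFour_sylow P
  rw [Set.ssubset_iff_of_subset]
  · obtain ⟨w, hw, hw8⟩ := exists_mem_gammaFiltration_three (P : Subgroup A4)
    refine ⟨(gammaFiltration ℂ _).symbol 3 w hw,
      fun g hg => gradedConj_symbol_eq hw hw8 g _, ?_⟩
    rintro ⟨z, hz⟩
    obtain ⟨⟨p, hp⟩, hp1, hp2⟩ := exists_involution_of_isKleinFour (P := (P : Subgroup A4))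
    refine kleinFour_image_obstruction hp (congrArg Subtype.val hp2)
      (fun h => hp1 (Subtype.ext h)) hw (hw8 _ hp1) odd_one z ?_
    rw [hz, one_zsmul]
  -- Restrictions are invariant because virtual characters of `A₄` are class functions.
  · rintro _ ⟨z, rfl⟩ g hg
    rw [gradedConj, gradedPullback_comp]
    refine DFinsupp.ext fun n => ?_
    obtain ⟨a, ha, h⟩ := RingFiltration.exists_cls _ (z n)
    rw [gradedPullback_apply_cls _ z ha h.symm, gradedPullback_apply_cls _ z ha h.symm]
    congr 1
    refine Subtype.ext <| funext fun x => ?_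
    change (a : A4 → ℂ) (g⁻¹ * x * (g⁻¹)⁻¹) = (a : A4 → ℂ) x
    exact apply_conj_eq _ _ _

end KleinFour

/-! ### Failure of the Mackey formula -/

section Mackey

theorem conjSubgroup_eq_of_normal {G : Type*} [Group G] (V : Subgroup G) [hV : V.Normal] (g : G) :
    conjSubgroup g V = V := by
  ext x
  rw [mem_conjSubgroup]
  constructor
  · intro h
    simpa [mul_assoc] using hV.conj_mem _ h g
  · intro h
    simpa using hV.conj_mem _ h g⁻¹

/-- For a normal subgroup, double cosets are cosets, so chosen representatives of the quotient
serve. -/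
theorem isDoubleCosetReps_of_normal {G : Type*} [Group G] [DecidableEq G] (V : Subgroup G)
    [V.Normal] [Fintype (G ⧸ V)] :
    IsDoubleCosetReps ⊤ V V (Finset.univ.image (Quotient.out : G ⧸ V → G)) := by
  refine ⟨fun _ _ => Subgroup.mem_top _, fun h _ => ⟨(h : G ⧸ V).out, ⟨by simp, 1, one_mem _,
    (h : G ⧸ V).out⁻¹ * h, ?_, by group⟩, ?_⟩⟩
  · exact QuotientGroup.eq.1 (QuotientGroup.out_eq' _)
  · rintro x ⟨hx, j, hj, k, hk, rfl⟩
    obtain ⟨q, -, rfl⟩ := Finset.mem_image.1 hx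
    rw [QuotientGroup.mk_mul, QuotientGroup.mk_mul, (QuotientGroup.eq_one_iff j).2 hj,
      (QuotientGroup.eq_one_iff k).2 hk, one_mul, mul_one, QuotientGroup.out_eq']

theorem exists_doubleCosetReps {G : Type*} [Group G] [Finite G] (V : Subgroup G) [V.Normal] :
    ∃ T : Finset G, IsDoubleCosetReps ⊤ V V T ∧ T.card = V.index := by
  classical
  have : Fintype (G ⧸ V) := Fintype.ofFinite _
  refine ⟨_, isDoubleCosetReps_of_normal V, ?_⟩
  rw [Finset.card_image_of_injective _ Quotient.out_injective, Finset.card_univ,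
    ← Nat.card_eq_fintype_card]
  rfl

/-- For normal `V`, every term of the Mackey formula for `res (ind [w])` is a conjugate of `[w]`,
hence `[w]` itself. The sum is `V.index • [w]`, an odd multiple that cannot be a restriction. -/
theorem not_isMackeyFunctor_of_odd_index (V : Subgroup A4) [V.Normal] [IsKleinFour V]
    (hodd : Odd V.index)
    (ind : ∀ {L H : Subgroup A4}, L ≤ H → GradedCharRing ℂ L →+ GradedCharRing ℂ H) :
    ¬ IsMackeyFunctor (fun H : Subgroup A4 => GradedCharRing ℂ H) (gradedRes ℂ) ind
        (gradedConj ℂ) := by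
  intro hM
  obtain ⟨w, hw, hw8⟩ := exists_mem_gammaFiltration_three V
  obtain ⟨T, hT, hcard⟩ := exists_doubleCosetReps V
  -- The subgroups in the Mackey formula are equal to `V` only propositionally. Stating the term for
  -- arbitrary `J₁`, `J₂` allows the equalities to be substituted.
  have hterm : ∀ (x : A4) (J₁ J₂ : Subgroup A4) (h₁ : J₁ ≤ V) (h₂ : J₂ ≤ V)
      (e : J₁ = conjSubgroup x J₂), J₁ = V → J₂ = V →
      ind h₁ (gradedConj ℂ x e (gradedRes ℂ h₂ ((gammaFiltration ℂ V).symbol 3 w hw))) =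
        (gammaFiltration ℂ V).symbol 3 w hw := by
    rintro x J₁ J₂ h₁ h₂ e hJ₁ hJ₂
    subst hJ₂ hJ₁
    exact ((congrArg (fun z => ind h₁ (gradedConj ℂ x e z)) (hM.res_self _ _)).trans
      (congrArg (ind h₁) (gradedConj_symbol_eq hw hw8 x e))).trans (hM.ind_self _ _)
  have hmackey : gradedRes ℂ (le_top : V ≤ ⊤) (ind le_top ((gammaFiltration ℂ V).symbol 3 w hw)) =
      T.card • (gammaFiltration ℂ V).symbol 3 w hw :=
    (hM.mackey le_top le_top T hT _).trans (Finset.sum_eq_card_nsmul fun x _ =>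
      hterm x _ _ _ _ _ (by rw [conjSubgroup_eq_of_normal, inf_idem])
        (by rw [conjSubgroup_eq_of_normal, inf_idem]))
  obtain ⟨⟨p, hp⟩, hp1, hp2⟩ := exists_involution_of_isKleinFour (P := V)
  refine kleinFour_image_obstruction hp (congrArg Subtype.val hp2)
    (fun h => hp1 (Subtype.ext h)) hw (hw8 _ hp1) (m := T.card) (by rw [hcard]; exact_mod_cast hodd)
    -- The induced class lives on the subgroup `⊤`, and this transports it to `A₄`.
    (gradedPullback ℂ (Subgroup.topEquiv (G := A4)).symm.toMonoidHom
      (ind le_top ((gammaFiltration ℂ V).symbol 3 w hw))) ?_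
  rw [gradedPullback_comp, natCast_zsmul]
  exact hmackey

theorem not_isMackeyFunctor
    (ind : ∀ {L H : Subgroup A4}, L ≤ H → GradedCharRing ℂ L →+ GradedCharRing ℂ H) :
    ¬ IsMackeyFunctor (fun H : Subgroup A4 => GradedCharRing ℂ H) (gradedRes ℂ) ind
        (gradedConj ℂ) := by
  have h4 : Nat.card (Fin 4) = 4 := by simp
  have := alternatingGroup.normal_kleinFour h4
  have hK := alternatingGroup.kleinFour_isKleinFour h4
  refine not_isMackeyFunctor_of_odd_index (alternatingGroup.kleinFour (Fin 4)) ?_ ind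
  have h := (alternatingGroup.kleinFour (Fin 4)).index_mul_card
  rw [alternatingGroup.card_of_card_eq_four h4, hK.card_four] at h
  exact ⟨1, by omega⟩

end Mackey

/-! ### A criterion for generating the associated graded ring -/

section SymbolsIn

variable {A : Type*} [CommRing A] (F : RingFiltration A)

/-- The elements of a filtered ring with symbol in a given subring of the associated graded ring. -/
def RingFiltration.symbolsIn (S : Subring F.Graded) : RingFiltration A where
  step n :=
    { carrier := {a | ∃ h : a ∈ F.step n, F.symbol n a h ∈ S}
      zero_mem' := ⟨zero_mem _, by
        rw [(F.symbol_eq_zero_iff (zero_mem _)).2 (zero_mem _)]; exact zero_mem S⟩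
      add_mem' := by
        rintro a b ⟨ha, ha'⟩ ⟨hb, hb'⟩
        exact ⟨add_mem ha hb, by rw [F.symbol_add ha hb]; exact add_mem ha' hb'⟩
      neg_mem' := by
        rintro a ⟨ha, ha'⟩
        exact ⟨neg_mem ha, by rw [F.symbol_neg ha]; exact neg_mem ha'⟩ }
  step_succ_le n := by
    rintro a ⟨ha, -⟩
    have ha' := F.step_succ_le n ha
    exact ⟨ha', by rw [(F.symbol_eq_zero_iff ha').2 ha]; exact zero_mem S⟩
  one_mem := ⟨F.one_mem, by rw [F.symbol_one]; exact Subring.one_mem S⟩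
  mul_mem := by
    rintro i j a b ⟨ha, ha'⟩ ⟨hb, hb'⟩
    exact ⟨F.mul_mem ha hb, by rw [← F.symbol_mul ha hb]; exact Subring.mul_mem S ha' hb'⟩

theorem RingFiltration.eq_top_of_step_le_symbolsIn {S : Subring F.Graded}
    (h : ∀ n, F.step n ≤ (F.symbolsIn S).step n) : S = ⊤ := by
  refine top_unique fun z _ => ?_
  induction z using DirectSum.induction_on with
  | zero => exact zero_mem S
  | of n x =>
    obtain ⟨a, ha, rfl⟩ := F.exists_cls x
    exact (h n ha).2
  | add x y hx hy => exact add_mem (hx (Subring.mem_top _)) (hy (Subring.mem_top _))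

end SymbolsIn

/-! ### Chern classes of `ρ` and `θ` and their relations -/

section Relations

/-- At each class representative either `ρ` takes the value `1` or `θ` vanishes. -/
theorem rhoChar_mul_standardChar : rhoChar * standardChar = standardChar := by
  refine a4_charRing_ext ?_ ?_ ?_ ?_
  · change (rhoChar : A4 → ℂ) _ * (standardChar : A4 → ℂ) _ = (standardChar : A4 → ℂ) _
    rw [rhoChar_one, one_mul]
  · change (rhoChar : A4 → ℂ) _ * (standardChar : A4 → ℂ) _ = (standardChar : A4 → ℂ) _
    rw [rhoChar_swap12swap34, one_mul]
  · change (rhoChar : A4 → ℂ) _ * (standardChar : A4 → ℂ) _ = (standardChar : A4 → ℂ) _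
    rw [standardChar_cycle123, mul_zero]
  · change (rhoChar : A4 → ℂ) _ * (standardChar : A4 → ℂ) _ = (standardChar : A4 → ℂ) _
    rw [standardChar_cycle123_sq, mul_zero]

theorem standardChar_sq :
    standardChar ^ 2 = 1 + rhoChar + rhoChar ^ 2 + (standardChar + standardChar) := by
  have hw := omega_sq
  refine a4_charRing_ext ?_ ?_ ?_ ?_
  all_goals
    change (standardChar : A4 → ℂ) _ ^ 2 = 1 + (rhoChar : A4 → ℂ) _ + (rhoChar : A4 → ℂ) _ ^ 2 +
      ((standardChar : A4 → ℂ) _ + (standardChar : A4 → ℂ) _)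
  · rw [rhoChar_one, standardChar_one]; norm_num
  · rw [rhoChar_swap12swap34, standardChar_swap12swap34]; norm_num
  · rw [rhoChar_cycle123, standardChar_cycle123]; linear_combination -hw
  · rw [rhoChar_cycle123_sq, standardChar_cycle123_sq]; linear_combination -hw

theorem rhoChar_sub_one_mul : (rhoChar - 1) * (3 - standardChar) = 3 * (rhoChar - 1) := by
  linear_combination -rhoChar_mul_standardChar

theorem three_sub_standardChar_sq : (3 - standardChar) ^ 2 =
    4 * (3 - standardChar) + 3 * (rhoChar - 1) + (rhoChar - 1) ^ 2 := by
  linear_combination standardChar_sq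

theorem augmentation_rhoChar : augmentation rhoChar = 1 := by
  apply Int.cast_injective (α := ℂ)
  rw [cast_augmentation, rhoChar_one, Int.cast_one]

theorem augmentation_standardChar : augmentation standardChar = 3 := by
  apply Int.cast_injective (α := ℂ)
  rw [cast_augmentation, standardChar_one, Int.cast_ofNat]

theorem rhoChar_sub_one_mem : rhoChar - 1 ∈ (gammaFiltration ℂ A4).step 1 :=
  mem_gammaFiltration_one (by rw [map_sub, augmentation_rhoChar, map_one, sub_self])

theorem three_sub_standardChar_mem : 3 - standardChar ∈ (gammaFiltration ℂ A4).step 2 := by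
  have h := gammaOp_mem_gammaFiltration 2 (x := standardChar - 3)
    (by rw [map_sub, augmentation_standardChar, map_ofNat, sub_self])
  simpa [gammaOp_standardChar_sub_three] using h

/-- The first Chern class of `ρ`. -/
def xClass : GradedCharRing ℂ A4 := (gammaFiltration ℂ A4).symbol 1 _ rhoChar_sub_one_mem

/-- The second Chern class of the standard representation. -/
def yClass : GradedCharRing ℂ A4 := (gammaFiltration ℂ A4).symbol 2 _ three_sub_standardChar_mem

theorem chernClass_eq_symbol {G : Type*} [Group G] (n : ℕ) (x : CharRing ℂ G) :
    chernClass n x = (gammaFiltration ℂ G).symbol n _ (gammaOp_mem_step n x) := rfl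

theorem chernClass_one_rhoChar : chernClass 1 rhoChar = xClass := by
  rw [chernClass_eq_symbol, xClass]
  exact RingFiltration.symbol_congr _ _ _ rfl
    (by rw [gammaOp_one, augmentation_rhoChar, Int.cast_one])

theorem chernClass_two_standardChar : chernClass 2 standardChar = yClass := by
  rw [chernClass_eq_symbol, yClass]
  exact RingFiltration.symbol_congr _ _ _ rfl (by
    rw [augmentation_standardChar, Int.cast_ofNat, gammaOp_standardChar_sub_three,
      if_neg two_ne_zero, if_neg (by norm_num), if_pos rfl])

/-- It equals `(ρ - 1)(3 - θ)`, a product of weights one and two. Membership in `Γ²` would give `3x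
= 0`, but the extra degree is needed to discard the term `3(ρ - 1)` in the relation between `4y` and
`x²`. -/
theorem three_mul_sub_one_mem : 3 * (rhoChar - 1) ∈ (gammaFiltration ℂ A4).step 3 := by
  have h : (rhoChar - 1) * (3 - standardChar) ∈ (gammaFiltration ℂ A4).step (1 + 2) :=
    RingFiltration.mul_mem _ rhoChar_sub_one_mem three_sub_standardChar_mem
  rw [rhoChar_sub_one_mul] at h
  exact h

theorem four_mul_add_sq_mem :
    4 * (3 - standardChar) + (rhoChar - 1) ^ 2 ∈ (gammaFiltration ℂ A4).step 3 := by
  have h : 4 * (3 - standardChar) + (rhoChar - 1) ^ 2 =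
      (3 - standardChar) * (3 - standardChar) - 3 * (rhoChar - 1) := by
    linear_combination -three_sub_standardChar_sq
  rw [h]
  have h4 : (3 - standardChar) * (3 - standardChar) ∈ (gammaFiltration ℂ A4).step (2 + 2) :=
    RingFiltration.mul_mem _ three_sub_standardChar_mem three_sub_standardChar_mem
  exact sub_mem (RingFiltration.step_succ_le _ 3 h4) three_mul_sub_one_mem

theorem three_mul_xClass : 3 * xClass = 0 := by
  have h := (gammaFiltration ℂ A4).symbol_zsmul rhoChar_sub_one_mem 3
  have h3 : 3 * xClass = (3 : ℤ) • xClass := by rw [zsmul_eq_mul, Int.cast_ofNat]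
  rw [h3, xClass, ← h, RingFiltration.symbol_eq_zero_iff, zsmul_eq_mul, Int.cast_ofNat]
  exact RingFiltration.step_succ_le _ 2 three_mul_sub_one_mem

theorem four_mul_yClass_add : 4 * yClass + xClass ^ 2 = 0 := by
  have h := (gammaFiltration ℂ A4).symbol_zsmul three_sub_standardChar_mem 4
  obtain ⟨hm, h2⟩ := (gammaFiltration ℂ A4).symbol_pow rhoChar_sub_one_mem 2
  have h4 : 4 * yClass = (4 : ℤ) • yClass := by rw [zsmul_eq_mul, Int.cast_ofNat]
  rw [h4, xClass, yClass, ← h, h2, ← RingFiltration.symbol_add _ _ hm,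
    RingFiltration.symbol_eq_zero_iff, zsmul_eq_mul, Int.cast_ofNat]
  exact four_mul_add_sq_mem

theorem twelve_mul_yClass : 12 * yClass = 0 := by
  linear_combination 3 * four_mul_yClass_add - xClass * three_mul_xClass

end Relations

/-! ### Lower bounds for the orders of `yᵏ` and `xyᵏ` -/

section Independence

theorem omega_im_ne_zero : omega.im ≠ 0 := by
  intro h
  have hre := congrArg Complex.re omega_sq
  simp [pow_two, h] at hre
  nlinarith [sq_nonneg (omega.re + 1 / 2)]

/-- Up to a unit `3ᵐ` is `(ω - 1)²ᵐ`, so cancelling leaves `a` divisible by `ω - 1`. Writing `a = (ω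
- 1)(p + qω)` and comparing coefficients of `1` and `ω` gives `p = 2q` and `a = -3q`. -/
theorem three_dvd_of_mul_eq {a : ℤ} {m : ℕ} {z : ℂ} (hz : z ∈ eisenstein)
    (h : (a : ℂ) * 3 ^ m = (omega - 1) ^ (2 * m + 1) * z) : 3 ∣ a := by
  have hω : omega ∈ eisenstein := ⟨0, 1, by simp⟩
  obtain ⟨p, q, hpq⟩ : (-omega) ^ m * z ∈ eisenstein := mul_mem (pow_mem (neg_mem hω) m) hz
  have h2 : (omega - 1) ^ 2 = 3 * -omega := by linear_combination omega_sq
  have h3 : (a : ℂ) = (omega - 1) * (p + q * omega) := by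
    rw [← hpq]
    apply mul_right_cancel₀ (pow_ne_zero m (three_ne_zero (α := ℂ)))
    rw [h, pow_succ, pow_mul, h2, mul_pow]
    ring
  have h4 : (a : ℂ) = ((-p - q : ℤ) : ℂ) + ((p - 2 * q : ℤ) : ℂ) * omega := by
    push_cast
    linear_combination h3 + (q : ℂ) * omega_sq
  have him := congrArg Complex.im h4
  simp only [Complex.intCast_im, Complex.add_im, Complex.mul_im, Complex.intCast_re, zero_mul,
    add_zero, zero_add] at him
  have h5 : p - 2 * q = 0 := by
    have := (mul_eq_zero.1 him.symm).resolve_right omega_im_ne_zero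
    exact_mod_cast this
  rw [h5] at h4
  have h6 : a = -p - q := by
    rw [Int.cast_zero, zero_mul, add_zero] at h4
    exact_mod_cast h4
  omega

/-- Elements of `Γ¹` vanish at the identity. The sequence `0ⁿ` imposes no condition in degree zero
and vanishing in all positive degrees. -/
theorem intCast_eq_zero_of_mem {a : ℤ}
    (h : a • (1 : CharRing ℂ A4) ∈ (gammaFiltration ℂ A4).step 1) :
    a = 0 := by
  have h' := a4_gammaFiltration_le
    (evalFiltration 1 ⊤ (fun n => 0 ^ n) (by simp) (fun n => ⟨0, Subring.mem_top _, by ring⟩)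
      (fun i j => ⟨1, Subring.mem_top _, by ring⟩)) ?_ ?_ ?_ 1 h
  · obtain ⟨s, -, hs⟩ := mem_evalFiltration_step.1 h'
    simpa using hs
  · refine mem_evalFiltration_step.2 ⟨0, zero_mem _, ?_⟩
    change (rhoChar : A4 → ℂ) _ - 1 = _
    rw [rhoChar_one]; ring
  · refine mem_evalFiltration_step.2 ⟨0, zero_mem _, ?_⟩
    change (rhoChar : A4 → ℂ) _ ^ 2 - 1 = _
    rw [rhoChar_one]; ring
  · refine mem_evalFiltration_step.2 ⟨0, zero_mem _, ?_⟩
    change ((3 : CharRing ℂ A4) : A4 → ℂ) _ - (standardChar : A4 → ℂ) _ = _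
    rw [ofNat_apply, standardChar_one]; ring

/-- At `(1 2)(3 4)` the value `4ᵏ⁺¹a` must be divisible by `4ᵏ⁺²`, so `4 ∣ a`. At `(1 2 3)` the
value `3ᵏ⁺¹a` must be divisible by `(ω - 1)²ᵏ⁺³`, so `3 ∣ a`. -/
theorem twelve_dvd_of_mem {a : ℤ} {k : ℕ} (h : a • (3 - standardChar) ^ (k + 1) ∈
    (gammaFiltration ℂ A4).step (2 * (k + 1) + 1)) : 12 ∣ a := by
  have hval : ∀ g, ((a • (3 - standardChar) ^ (k + 1) : CharRing ℂ A4) : A4 → ℂ) g =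
      a * (3 - (standardChar : A4 → ℂ) g) ^ (k + 1) := by
    intro g
    simp [ofNat_apply]
  obtain ⟨m, hm⟩ := exists_eval_swap12swap34_eq h
  obtain ⟨p, q, hpq⟩ := exists_eval_cycle123_eq h
  rw [hval, standardChar_cycle123, sub_zero] at hpq
  have h3 := three_dvd_of_mul_eq ⟨p, q, rfl⟩ hpq
  rw [hval, standardChar_swap12swap34, show (2 * (k + 1) + 1 + 1) / 2 = (k + 1) + 1 by omega,
    pow_succ _ (k + 1), show (3 - -1 : ℂ) = 4 by norm_num] at hm
  have h4 : (a : ℂ) = 4 * m := by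
    apply mul_right_cancel₀ (pow_ne_zero (k + 1) (show (4 : ℂ) ≠ 0 by norm_num))
    rw [hm]
    ring
  have h4' : a = 4 * m := by exact_mod_cast h4
  omega

/-- Only the value at `(1 2 3)` gives information, as `ρ - 1` vanishes at involutions. One factor `ω
- 1` cancels before `three_dvd_of_mul_eq` applies. -/
theorem three_dvd_of_mem {b : ℤ} {k : ℕ} (h : b • ((rhoChar - 1) * (3 - standardChar) ^ k) ∈
    (gammaFiltration ℂ A4).step (2 * k + 1 + 1)) : 3 ∣ b := by
  obtain ⟨p, q, hpq⟩ := exists_eval_cycle123_eq h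
  have hval : ((b • ((rhoChar - 1) * (3 - standardChar) ^ k) : CharRing ℂ A4) : A4 → ℂ) cycle123 =
      b * ((omega - 1) * 3 ^ k) := by
    simp [ofNat_apply, rhoChar_cycle123, standardChar_cycle123]
  rw [hval] at hpq
  refine three_dvd_of_mul_eq (m := k) (z := p + q * omega) ⟨p, q, rfl⟩ ?_
  have hne : omega - 1 ≠ 0 := fun h0 => omega_im_ne_zero (by
    rw [sub_eq_zero.1 h0, Complex.one_im])
  apply mul_left_cancel₀ hne
  linear_combination hpq

end Independence

/-! ### The presentation of the graded character ring -/

section Presentation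

open Polynomial in
-- Since `x` has degree one and `y` degree two, `A(y)` lives in even degrees and `xB(y)` in odd
-- ones, with one monomial per degree. A vanishing sum therefore vanishes monomial by monomial.
theorem smul_mem_step_of_aeval_add_eq_zero (A B : ℤ[X]) (j : ℕ)
    (h : aeval yClass A + xClass * aeval yClass B = 0) :
    A.coeff j • (3 - standardChar) ^ j ∈ (gammaFiltration ℂ A4).step (2 * j + 1) ∧
    B.coeff j • ((rhoChar - 1) * (3 - standardChar) ^ j) ∈
      (gammaFiltration ℂ A4).step (2 * j + 1 + 1) := by
  have hy : ∀ (a : ℤ) (k : ℕ), ∃ hm, a • yClass ^ k =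
      (gammaFiltration ℂ A4).symbol (2 * k) (a • (3 - standardChar) ^ k) hm := by
    intro a k
    obtain ⟨hm, hk⟩ := (gammaFiltration ℂ A4).symbol_pow three_sub_standardChar_mem k
    exact ⟨zsmul_mem hm a, by rw [RingFiltration.symbol_zsmul _ hm, yClass, hk]⟩
  have hx : ∀ (a : ℤ) (k : ℕ), ∃ hm, xClass * a • yClass ^ k = (gammaFiltration ℂ A4).symbol
      (2 * k + 1) (a • ((rhoChar - 1) * (3 - standardChar) ^ k)) hm := by
    intro a k
    obtain ⟨hm, hk⟩ := hy a k
    rw [hk, xClass, RingFiltration.symbol_mul]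
    have e : (rhoChar - 1) * a • (3 - standardChar) ^ k =
      a • ((rhoChar - 1) * (3 - standardChar) ^ k) := mul_smul_comm _ _ _
    have hmem : a • ((rhoChar - 1) * (3 - standardChar) ^ k) ∈
        (gammaFiltration ℂ A4).step (2 * k + 1) := by
      rw [← e, add_comm]
      exact RingFiltration.mul_mem _ rhoChar_sub_one_mem hm
    exact ⟨hmem, (gammaFiltration ℂ A4).symbol_congr _ _ (add_comm _ _) e⟩
  choose hym hy using hy
  choose hxm hx using hx
  -- The common bound exceeds both degrees and `j`, so that index `j` occurs in both sums even when
  -- its coefficient is zero.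
  have hA : aeval yClass A = ∑ k ∈ Finset.range (max A.natDegree B.natDegree + j + 1),
      (gammaFiltration ℂ A4).symbol (2 * k) _ (hym (A.coeff k) k) := by
    rw [aeval_eq_sum_range' (n := max A.natDegree B.natDegree + j + 1)
      (lt_of_le_of_lt (le_max_left A.natDegree B.natDegree) (by omega))]
    exact Finset.sum_congr rfl fun k _ => hy _ _
  have hB : xClass * aeval yClass B = ∑ k ∈ Finset.range (max A.natDegree B.natDegree + j + 1),
      (gammaFiltration ℂ A4).symbol (2 * k + 1) _ (hxm (B.coeff k) k) := by
    rw [aeval_eq_sum_range' (n := max A.natDegree B.natDegree + j + 1)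
      (lt_of_le_of_lt (le_max_right A.natDegree B.natDegree) (by omega)),
      Finset.mul_sum]
    exact Finset.sum_congr rfl fun k _ => hx _ _
  have hj : j ∈ Finset.range (max A.natDegree B.natDegree + j + 1) := by simp
  rw [hA, hB] at h
  constructor
  · have h' := DFunLike.congr_fun h (2 * j)
    rw [DirectSum.add_apply, DirectSum.sum_apply, DirectSum.sum_apply,
      Finset.sum_eq_single_of_mem j hj fun k _ hk =>
        RingFiltration.symbol_apply_of_ne _ (by omega) _,
      Finset.sum_eq_zero fun k _ => RingFiltration.symbol_apply_of_ne _ (by omega) _, add_zero,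
      RingFiltration.symbol_apply_self] at h'
    exact (RingFiltration.cls_eq_zero_iff _ _).1 h'
  · have h' := DFunLike.congr_fun h (2 * j + 1)
    rw [DirectSum.add_apply, DirectSum.sum_apply, DirectSum.sum_apply,
      Finset.sum_eq_zero fun k _ => RingFiltration.symbol_apply_of_ne _ (by omega) _, zero_add,
      Finset.sum_eq_single_of_mem j hj fun k _ hk =>
        RingFiltration.symbol_apply_of_ne _ (by omega) _,
      RingFiltration.symbol_apply_self] at h'
    exact (RingFiltration.cls_eq_zero_iff _ _).1 h'

open MvPolynomial in
/-- The ideal of relations between the generators of the graded character ring of `A₄`. -/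
abbrev a4Relations : Ideal (MvPolynomial (Fin 2) ℤ) :=
  Ideal.span ({3 * X 0, 12 * X 1, 4 * X 1 + X 0 ^ 2} : Set (MvPolynomial (Fin 2) ℤ))

open MvPolynomial in
/-- The map from the presented ring to the graded character ring of `A₄`. -/
def a4PresentationHom : (MvPolynomial (Fin 2) ℤ ⧸ a4Relations) →+* GradedCharRing ℂ A4 :=
  Ideal.Quotient.lift a4Relations (aeval ![xClass, yClass]).toRingHom (by
    intro p hp
    rw [← RingHom.mem_ker]
    refine (Ideal.span_le.2 ?_) hp
    rintro q (rfl | rfl | rfl)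
    · change aeval ![xClass, yClass] _ = _
      simpa using three_mul_xClass
    · change aeval ![xClass, yClass] _ = _
      simpa using twelve_mul_yClass
    · change aeval ![xClass, yClass] _ = _
      simpa using four_mul_yClass_add)

open MvPolynomial in
theorem a4PresentationHom_X_zero :
    a4PresentationHom (Ideal.Quotient.mk _ (X 0)) = xClass := by
  change aeval ![xClass, yClass] _ = _
  simp

open MvPolynomial in
theorem a4PresentationHom_X_one :
    a4PresentationHom (Ideal.Quotient.mk _ (X 1)) = yClass := by
  change aeval ![xClass, yClass] _ = _
  simp

/-- The elements whose symbol lies in the range form a ring filtration, so it suffices to test the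
generators. The one that is not itself a lift of `x` or `y` is `ρ² - 1 = (ρ - 1)² + 2(ρ - 1)`. -/
theorem a4PresentationHom_surjective : Function.Surjective a4PresentationHom := by
  rw [← RingHom.range_eq_top]
  have hx : rhoChar - 1 ∈ ((gammaFiltration ℂ A4).symbolsIn a4PresentationHom.range).step 1 :=
    ⟨rhoChar_sub_one_mem, _, a4PresentationHom_X_zero⟩
  refine RingFiltration.eq_top_of_step_le_symbolsIn _ (a4_gammaFiltration_le _ hx ?_
    ⟨three_sub_standardChar_mem, _, a4PresentationHom_X_one⟩)
  have e : rhoChar ^ 2 - 1 = (rhoChar - 1) * (rhoChar - 1) + ((rhoChar - 1) + (rhoChar - 1)) := by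
    ring
  rw [e]
  exact add_mem (RingFiltration.step_succ_le _ 1 (RingFiltration.mul_mem _ hx hx)) (add_mem hx hx)

open Polynomial in
-- The relation `x² = -4y` makes the span of `1` and `x` over polynomials in `y` stable under
-- multiplication by `x`, with `x(A + xB) = -4yB + xA`.
theorem exists_normal_form (q : MvPolynomial (Fin 2) ℤ ⧸ a4Relations) : ∃ A B : ℤ[X],
    q = aeval (Ideal.Quotient.mk a4Relations (MvPolynomial.X 1)) A +
      Ideal.Quotient.mk a4Relations (MvPolynomial.X 0) *
        aeval (Ideal.Quotient.mk a4Relations (MvPolynomial.X 1)) B := by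
  have hrel : 4 * Ideal.Quotient.mk a4Relations (MvPolynomial.X 1) +
      Ideal.Quotient.mk a4Relations (MvPolynomial.X 0) ^ 2 = 0 := by
    rw [← map_ofNat (Ideal.Quotient.mk a4Relations) 4, ← map_mul, ← map_pow, ← map_add,
      Ideal.Quotient.eq_zero_iff_mem]
    exact Ideal.subset_span (by simp)
  obtain ⟨p, rfl⟩ := Ideal.Quotient.mk_surjective q
  induction p using MvPolynomial.induction_on with
  | C a => exact ⟨C a, 0, by simp⟩
  | add p p' hp hp' =>
    obtain ⟨A, B, h⟩ := hp
    obtain ⟨A', B', h'⟩ := hp'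
    exact ⟨A + A', B + B', by rw [map_add, h, h', map_add, map_add]; ring⟩
  | mul_X p i hp =>
    obtain ⟨A, B, h⟩ := hp
    fin_cases i
    · refine ⟨-(4 * X * B), A, ?_⟩
      simp only [Fin.zero_eta, map_mul, map_neg, aeval_X, map_ofNat, h]
      linear_combination (aeval (Ideal.Quotient.mk a4Relations (MvPolynomial.X 1)) B) * hrel
    · refine ⟨A * X, B * X, ?_⟩
      simp only [Fin.mk_one, map_mul, aeval_X, h]
      ring

open Polynomial in
-- For an element of the kernel in normal form, the constant coefficient of `A` is zero, its other
-- coefficients are divisible by `12`, and those of `B` by `3`. The relations `12y = 0` and `3x = 0`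
-- then kill every monomial.
theorem a4PresentationHom_injective : Function.Injective a4PresentationHom := by
  rw [injective_iff_map_eq_zero]
  intro q hq
  obtain ⟨A, B, rfl⟩ := exists_normal_form q
  have haeval : ∀ P : ℤ[X],
      a4PresentationHom (aeval (Ideal.Quotient.mk a4Relations (MvPolynomial.X 1)) P) =
        aeval yClass P := by
    intro P
    rw [← a4PresentationHom_X_one]
    exact (aeval_algHom_apply a4PresentationHom.toIntAlgHom _ P).symm
  rw [map_add, map_mul, a4PresentationHom_X_zero, haeval, haeval] at hq
  have hx : 3 * Ideal.Quotient.mk a4Relations (MvPolynomial.X 0) = 0 := by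
    rw [← map_ofNat (Ideal.Quotient.mk a4Relations) 3, ← map_mul, Ideal.Quotient.eq_zero_iff_mem]
    exact Ideal.subset_span (by simp)
  have hy : 12 * Ideal.Quotient.mk a4Relations (MvPolynomial.X 1) = 0 := by
    rw [← map_ofNat (Ideal.Quotient.mk a4Relations) 12, ← map_mul, Ideal.Quotient.eq_zero_iff_mem]
    exact Ideal.subset_span (by simp)
  rw [aeval_eq_sum_range, aeval_eq_sum_range, Finset.mul_sum, Finset.sum_eq_zero,
    Finset.sum_eq_zero, add_zero]
  · intro k _
    obtain ⟨m, hm⟩ := three_dvd_of_mem (smul_mem_step_of_aeval_add_eq_zero A B k hq).2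
    rw [hm, zsmul_eq_mul]
    push_cast
    linear_combination (m * Ideal.Quotient.mk a4Relations (MvPolynomial.X 1) ^ k) * hx
  · intro k _
    cases k with
    | zero =>
      have h0 := (smul_mem_step_of_aeval_add_eq_zero A B 0 hq).1
      rw [pow_zero] at h0
      rw [intCast_eq_zero_of_mem h0, zero_smul]
    | succ k =>
      obtain ⟨m, hm⟩ := twelve_dvd_of_mem (smul_mem_step_of_aeval_add_eq_zero A B (k + 1) hq).1
      rw [hm, zsmul_eq_mul]
      push_cast
      linear_combination (m * Ideal.Quotient.mk a4Relations (MvPolynomial.X 1) ^ k) * hy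

end Presentation

end

end GradedCharacterRing

open GradedCharacterRing

theorem mainTheorem7 :
    (¬ ∃ ind : ∀ {L H : Subgroup A4}, L ≤ H → GradedCharRing ℂ L →+ GradedCharRing ℂ H,
      IsMackeyFunctor (fun H : Subgroup A4 => GradedCharRing ℂ H) (gradedRes ℂ) ind
        (gradedConj ℂ)) ∧
    (∀ P : Sylow 2 A4, IsKleinFour P ∧
      Set.range (gradedPullback ℂ (P : Subgroup A4).subtype) ⊂
        {z : GradedCharRing ℂ (P : Subgroup A4) |
          ∀ (g : A4) (hg : g ∈ Subgroup.normalizer ((P : Subgroup A4) : Set A4)),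
            gradedConj ℂ g (conjSubgroup_of_mem_normalizer hg) z = z}) ∧
    (∃ ρ : Representation ℂ A4 ℂ,
      ρ cycle123 1 = Complex.exp (2 * Real.pi * Complex.I / 3) ∧ ρ swap12swap34 1 = 1 ∧
      ∃ e : (MvPolynomial (Fin 2) ℤ ⧸ Ideal.span
          ({3 * MvPolynomial.X 0, 12 * MvPolynomial.X 1,
            4 * MvPolynomial.X 1 + MvPolynomial.X 0 ^ 2} : Set (MvPolynomial (Fin 2) ℤ))) ≃+*
          GradedCharRing ℂ A4,
        e (Ideal.Quotient.mk _ (MvPolynomial.X 0)) = chernClass 1 (charOf ρ) ∧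
        e (Ideal.Quotient.mk _ (MvPolynomial.X 1)) = chernClass 2 standardChar) := by
  refine ⟨fun ⟨ind, h⟩ => not_isMackeyFunctor ind h,
    fun P => ⟨isKleinFour_sylow P, range_gradedPullback_ssubset P⟩,
    linearRep a4Char, ?_, ?_,
    RingEquiv.ofBijective a4PresentationHom
      ⟨a4PresentationHom_injective, a4PresentationHom_surjective⟩, ?_, ?_⟩
  · rw [linearRep_apply_one, a4Char_cycle123, omega]
  · rw [linearRep_apply_one, a4Char_swap12swap34, Units.val_one]
  · exact a4PresentationHom_X_zero.trans chernClass_one_rhoChar.symm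
  · exact a4PresentationHom_X_one.trans chernClass_two_standardChar.symm
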